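/- For an integer $n$ let $I_n(x)=\sum_{k\ge 0}\frac{(x/2)^{2k+|n|}}{k!\,(k+|n|)!}$ be the modified Bessel function of the first kind, and for $n\in\mathbb Z$, $\alpha>0$, $\beta\ge 0$ let $$Q_n(\alpha,\beta)=\int_\beta^\infty \frac{x^n}{\alpha^{n-1}}\,e^{-(\alpha^2+x^2)/2}\,I_{n-1}(\alpha x)\,dx$$ be the generalized Marcum $Q$-function. Let $\gamma(s,x)=\int_0^x t^{s-1}e^{-t}\,dt$, $(t)_n=t(t+1)\cdots(t+n-1)$, and for integers $\ell\ge 1$, $i\ge 0$ and real $c,z$ $$\mathcal A_i(\ell,c;z)=\frac{(-1)^{\ell-1}}{(\ell-1)!}\sum_{k=0}^{\lfloor i/2\rfloor}\frac{(-1)^k(\ell-i+k)_{i-k}\,(c-i-1+k)_{i-2k}}{(i-2k)!\,k!}\,z^k .$$ Let $m\ge 1$ be an integer and let $R_1,R_2$ be correlated Nakagami-$m$ random variables, i.e. for some $w_1,w_2>0$ and $0<p<1$ the pair $(R_1,R_2)$ has the density $$f(x,y)=\frac{4\,m^{m+1}(xy)^m}{(m-1)!\,w_1w_2(1-p)\left(\sqrt{w_1w_2p}\right)^{m-1}}\exp\left(-\frac{m}{1-p}\left(\frac{x^2}{w_1}+\frac{y^2}{w_2}\right)\right)I_{m-1}\left(\frac{2m\sqrt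 p\,xy}{(1-p)\sqrt{w_1w_2}}\right),\qquad x,y>0,$$ and $f(x,y)=0$ otherwise. Let $\Omega_1=\mathbb E[R_1^2]$, $\Omega_2=\mathbb E[R_2^2]$, let $\rho$ be the (power) correlation coefficient, i.e. the Pearson correlation coefficient of $R_1^2$ and $R_2^2$, and let $\hat R_j=R_j/\sqrt{\Omega_j}$ for $j=1,2$. Put $a=\sqrt{\frac{2m}{1-\rho}}$ and $b=a\sqrt\rho$. Then for all $r_1,r_2>0$ the joint CDF $F_{\hat R_1,\hat R_2}(r_1,r_2)=\Pr(\hat R_1\le r_1,\hat R_2\le r_2)$ equals $$\begin{aligned}F_{\hat R_1,\hat R_2}(r_1,r_2)={}&\frac{\gamma(m,m r_2^2)}{(m-1)!}-e^{-mr_1^2}\sum_{k=0}^{m-1}\frac{(mr_1^2)^k}{k!}\,Q_{1-k}(r_2a,r_1b)\\&+e^{-mr_2^2}\sum_{k=0}^{m-1}\sum_{i=1}^{m-k}\sum_{r=0}^{2(i-1)}\frac{(1-\rho)^r}{k!\,\rho^r}\left(\frac{mr_1^2}{\rho}\right)^{k+i-r-1}\mathcal A_r\left(i,k+i;\frac{(r_1r_2ab)^2}{4}\right)Q_{2-k-i+r}(r_2b,r_1a).\end{aligned}$$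 Moreover, for all real $r_1,r_2$ the joint CDF of $R_1$ and $R_2$ is $$F_{R_1,R_2}(r_1,r_2)=F_{\hat R_1,\hat R_2}\left(\frac{r_1}{\sqrt{\Omega_1}},\frac{r_2}{\sqrt{\Omega_2}}\right).$$ -/

import Mathlib

open MeasureTheory ProbabilityTheory

noncomputable section

namespace BivariateNakagami

/-- The modified Bessel function of the first kind of integer order `n`, given by its power series.
For integer orders `I_{-n} = I_n`, hence the absolute value `n.natAbs` of the order. -/
def besselI (n : ℤ) (x : ℝ) : ℝ :=
  ∑' k : ℕ, (x / 2) ^ (2 * k + n.natAbs) / ((k.factorial : ℝ) * ((k + n.natAbs).factorial : ℝ))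

/-- The generalized Marcum `Q`-function of integer order `m` (of either sign),
for `a > 0` and `b ≥ 0`. -/
def marcumQ (m : ℤ) (a b : ℝ) : ℝ :=
  ∫ x in Set.Ioi b,
    x ^ m / a ^ (m - 1) * Real.exp (-(a ^ 2 + x ^ 2) / 2) * besselI (m - 1) (a * x)

/-- The lower incomplete gamma function `γ(s, x)`, for `s > 0` and `x ≥ 0`. -/
def lowerGamma (s x : ℝ) : ℝ :=
  ∫ t in (0 : ℝ)..x, t ^ (s - 1) * Real.exp (-t)

/-- The Pochhammer symbol `(t)_n = t (t + 1) ⋯ (t + n - 1)`. -/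
def poch (t : ℝ) (n : ℕ) : ℝ :=
  (ascPochhammer ℝ n).eval t

/-- The polynomials `A_i(b, c; z)` in `z`, for a positive integer `b`. Note that `k ≤ i / 2` in the
sum, so that the natural-number differences `i - k` and `i - 2 * k` are not truncated. -/
def coeffA (i b : ℕ) (c z : ℝ) : ℝ :=
  (-1) ^ (b - 1) / ((b - 1).factorial : ℝ) *
    ∑ k ∈ Finset.range (i / 2 + 1),
      (-1) ^ k * poch ((b : ℝ) - i + k) (i - k) * poch (c - i - 1 + k) (i - 2 * k) /
        (((i - 2 * k).factorial : ℝ) * (k.factorial : ℝ)) * z ^ k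

/-- Nakagami's joint density of two correlated Nakagami-`m` variables, for a positive integer `m`,
scales `w₁, w₂ > 0` and dependence parameter `0 < p < 1`. -/
def density (m : ℕ) (w₁ w₂ p x y : ℝ) : ℝ :=
  if 0 < x ∧ 0 < y then
    4 * (m : ℝ) ^ (m + 1) * (x * y) ^ m /
        (((m - 1).factorial : ℝ) * w₁ * w₂ * (1 - p) * √(w₁ * w₂ * p) ^ (m - 1)) *
      Real.exp (-((m : ℝ) / (1 - p)) * (x ^ 2 / w₁ + y ^ 2 / w₂)) *
      besselI ((m : ℤ) - 1) (2 * m * √p * x * y / ((1 - p) * √(w₁ * w₂)))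
  else 0

/-- `X` and `Y` are correlated Nakagami-`m` random variables: their joint law has
Nakagami's bivariate density, for some scales and some dependence parameter. -/
def IsCorrelatedNakagami {S : Type*} [MeasurableSpace S] (m : ℕ) (X Y : S → ℝ)
    (P : Measure S) : Prop :=
  ∃ w₁ w₂ p : ℝ, 0 < w₁ ∧ 0 < w₂ ∧ 0 < p ∧ p < 1 ∧
    HasLaw (fun s => (X s, Y s))
      ((volume : Measure (ℝ × ℝ)).withDensity
        (fun z => ENNReal.ofReal (density m w₁ w₂ p z.1 z.2))) P

/-- The power correlation coefficient of `X` and `Y`, i.e. the Pearson correlation coefficient of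
`X ^ 2` and `Y ^ 2`. -/
def powerCorrelation {S : Type*} [MeasurableSpace S] (X Y : S → ℝ) (P : Measure S) : ℝ :=
  cov[fun s => X s ^ 2, fun s => Y s ^ 2; P] /
    √(Var[fun s => X s ^ 2; P] * Var[fun s => Y s ^ 2; P])

/-- The joint cumulative distribution function of `X` and `Y`. -/
def jointCDF {S : Type*} [MeasurableSpace S] (X Y : S → ℝ) (P : Measure S) (x y : ℝ) : ℝ :=
  P.real {s | X s ≤ x ∧ Y s ≤ y}

end BivariateNakagami

end

open BivariateNakagami

namespace BivariateNakagami

/-! Dividing each variable by the square root of its scale reduces to scales equal to 1, that is to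
`normalizedLaw`. Expanding the Bessel function shows that this law is a negative binomial mixture of
products of equal Nakagami laws (`hasSum_density`). Moments of the mixture give second moments 1 and
power correlation `p`, so the scales are `Ω₁`, `Ω₂`, and `p = ρ`. The same mixture gives the law of
the second variable, hence the incomplete gamma term.

It remains to subtract the probability that the first variable exceeds `r₁` while the second is at
most `r₂`. For a fixed value `s` of the first variable, integrating the density over the second one
gives a Nakagami density at `s` times an incomplete Marcum integral. The reflection formula
`marcumP_eq_marcumQ` turns that integral into a Marcum function of order `1 - m` with exchanged
arguments. The remaining integral over `s` has the explicit antiderivative `-marcumTail`: Poisson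
weights times Marcum functions telescope on differentiation, and what remains cancels because
Poisson weight times `marcumStep` is symmetric under exchange of the two variables
(`poisson_mul_marcumStep`).

This yields a single sum of Marcum functions of orders `1, ..., m` in place of the triple sum with
the polynomials `coeffA`. The two agree by a finite identity valid for arbitrary values in place of
the Marcum functions (`sum_coeffA`): after regrouping, an alternating binomial sum kills nearly
every term. -/

/-! ### Power series of the Bessel function -/

/-- The entire function `∑ t ^ k / (k! (k + ν)!)`, a normalisation of the modified Bessel
function of order `ν`. -/
noncomputable def besselSeries (ν : ℕ) (t : ℝ) : ℝ :=
  ∑' k : ℕ, t ^ k / ((k.factorial : ℝ) * ((k + ν).factorial : ℝ))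

lemma abs_besselSeries_term_le (ν : ℕ) (t : ℝ) (k : ℕ) :
    |t ^ k / ((k.factorial : ℝ) * ((k + ν).factorial : ℝ))| ≤ |t| ^ k / (k.factorial : ℝ) := by
  have h1 : (0 : ℝ) < k.factorial := by positivity
  have h2 : (1 : ℝ) ≤ (k + ν).factorial := by exact_mod_cast Nat.succ_le_of_lt (k + ν).factorial_pos
  rw [abs_div, abs_pow, abs_of_pos (by positivity : (0 : ℝ) < k.factorial * (k + ν).factorial)]
  gcongr
  nlinarith

lemma summable_besselSeries (ν : ℕ) (t : ℝ) :
    Summable fun k : ℕ => t ^ k / ((k.factorial : ℝ) * ((k + ν).factorial : ℝ)) :=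
  Summable.of_norm_bounded (Real.summable_pow_div_factorial |t|)
    fun k => abs_besselSeries_term_le ν t k

lemma hasSum_besselSeries (ν : ℕ) (t : ℝ) :
    HasSum (fun k : ℕ => t ^ k / ((k.factorial : ℝ) * ((k + ν).factorial : ℝ)))
      (besselSeries ν t) :=
  (summable_besselSeries ν t).hasSum

lemma besselI_eq (n : ℤ) (x : ℝ) :
    besselI n x = (x / 2) ^ n.natAbs * besselSeries n.natAbs (x ^ 2 / 4) := by
  rw [besselI, besselSeries, ← tsum_mul_left]
  refine tsum_congr fun k => ?_
  rw [show x ^ 2 / 4 = (x / 2) ^ 2 by ring, ← pow_mul]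
  ring

/-- Termwise differentiation cancels a factor of `k!`, and the index shift turns order `ν` into `ν +
1`. -/
lemma hasDerivAt_besselSeries (ν : ℕ) (t : ℝ) :
    HasDerivAt (besselSeries ν) (besselSeries (ν + 1) t) t := by
  have key : HasDerivAt (fun s => ∑' k : ℕ, s ^ k / ((k.factorial : ℝ) * ((k + ν).factorial : ℝ)))
      (∑' k : ℕ, (k * t ^ (k - 1)) / ((k.factorial : ℝ) * ((k + ν).factorial : ℝ))) t := by
    refine hasDerivAt_tsum_of_isPreconnected (F := ℝ)
      (g := fun k s => s ^ k / ((k.factorial : ℝ) * ((k + ν).factorial : ℝ)))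
      (g' := fun k s => (k * s ^ (k - 1)) / ((k.factorial : ℝ) * ((k + ν).factorial : ℝ)))
      -- On the ball of radius `|t| + 1` the differentiated terms are dominated by those of the
      -- differentiated exponential series.
      (u := fun k : ℕ => k * (|t| + 1) ^ (k - 1) / (k.factorial : ℝ))
      (t := Metric.ball (0 : ℝ) (|t| + 1)) (y₀ := (0 : ℝ)) ?_ Metric.isOpen_ball
      (convex_ball _ _).isPreconnected (fun k y _ => ?_) (fun k y hy => ?_) ?_ ?_ ?_
    · rw [← summable_nat_add_iff 1]
      refine (Real.summable_pow_div_factorial (|t| + 1)).congr fun k => ?_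
      rw [Nat.factorial_succ, Nat.add_sub_cancel]
      push_cast
      field_simp
    · exact (hasDerivAt_pow k y).div_const _
    · have hy' : |y| ≤ |t| + 1 := by
        have := Metric.mem_ball.1 hy
        rw [Real.dist_eq, sub_zero] at this
        exact this.le
      have h1 : (0 : ℝ) < k.factorial := by positivity
      have h2 : (1 : ℝ) ≤ (k + ν).factorial := by
        exact_mod_cast Nat.succ_le_of_lt (k + ν).factorial_pos
      rw [Real.norm_eq_abs, abs_div, abs_mul, abs_pow, Nat.abs_cast,
        abs_of_pos (by positivity : (0 : ℝ) < k.factorial * (k + ν).factorial)]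
      gcongr
      nlinarith
    · exact Metric.mem_ball_self (by positivity)
    · exact summable_besselSeries ν 0
    · rw [Metric.mem_ball, Real.dist_eq, sub_zero]
      linarith
  refine key.congr_deriv ?_
  have hs : Summable fun k : ℕ =>
      (k * t ^ (k - 1)) / ((k.factorial : ℝ) * ((k + ν).factorial : ℝ)) := by
    rw [← summable_nat_add_iff 1]
    refine (summable_besselSeries (ν + 1) t).congr fun k => ?_
    rw [Nat.factorial_succ k, Nat.add_sub_cancel, show k + 1 + ν = k + (ν + 1) by ring]
    push_cast
    field_simp
  rw [hs.tsum_eq_zero_add, besselSeries]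
  simp only [Nat.cast_zero, zero_mul, zero_div, zero_add]
  refine tsum_congr fun k => ?_
  rw [Nat.factorial_succ k, Nat.add_sub_cancel, show k + 1 + ν = k + (ν + 1) by ring]
  push_cast
  field_simp

lemma continuous_besselSeries (ν : ℕ) : Continuous (besselSeries ν) :=
  continuous_iff_continuousAt.2 fun t => (hasDerivAt_besselSeries ν t).continuousAt

/-- Coefficientwise this is `(ν + 1) + k` cancelling against `(k + ν + 1)!`; it is the classical
three-term recurrence of the Bessel functions. -/
lemma besselSeries_recurrence (ν : ℕ) (t : ℝ) :
    (ν + 1) * besselSeries (ν + 1) t + t * besselSeries (ν + 2) t = besselSeries ν t := by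
  have h0 := hasSum_besselSeries ν t
  have h1 := (hasSum_besselSeries (ν + 1) t).mul_left (ν + 1 : ℝ)
  have h2 : HasSum (fun k : ℕ =>
      (k : ℝ) * (t ^ k / ((k.factorial : ℝ) * ((k + (ν + 1)).factorial : ℝ))))
      (t * besselSeries (ν + 2) t) := by
    rw [← hasSum_nat_add_iff' 1]
    simp only [Finset.range_one, Finset.sum_singleton, Nat.cast_zero, zero_mul, sub_zero]
    refine ((hasSum_besselSeries (ν + 2) t).mul_left t).congr_fun fun k => ?_
    rw [Nat.factorial_succ k, show k + 1 + (ν + 1) = k + (ν + 2) by ring]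
    push_cast
    field_simp
    ring
  refine (h1.add h2).unique (h0.congr_fun fun k => ?_)
  rw [← add_assoc k ν 1, Nat.factorial_succ (k + ν)]
  push_cast
  field_simp
  ring

lemma besselSeries_nonneg (ν : ℕ) {t : ℝ} (ht : 0 ≤ t) : 0 ≤ besselSeries ν t :=
  tsum_nonneg fun _ => by positivity

/-- Termwise comparison with `cosh x / ν!`, using `k! ν! ≤ (k + ν)!` and `(2k)! ≤ 4 ^ k (k!) ^ 2`.
-/
lemma besselSeries_le (ν : ℕ) {x : ℝ} (hx : 0 ≤ x) :
    besselSeries ν (x ^ 2 / 4) ≤ Real.exp x / (ν.factorial : ℝ) := by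
  have h1 : HasSum (fun k : ℕ => x ^ (2 * k) / ((2 * k).factorial : ℝ) / (ν.factorial : ℝ))
      (Real.cosh x / (ν.factorial : ℝ)) := (Real.hasSum_cosh x).div_const _
  have h2 : besselSeries ν (x ^ 2 / 4) ≤ Real.cosh x / (ν.factorial : ℝ) := by
    refine hasSum_le (fun k => ?_) (hasSum_besselSeries ν _) h1
    have e1 : (ν.factorial * k.factorial : ℝ) ≤ (k + ν).factorial := by
      have := Nat.le_of_dvd (Nat.factorial_pos _) (Nat.factorial_mul_factorial_dvd_factorial_add k ν)
      rw [mul_comm]; exact_mod_cast this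
    have e2 : ((2 * k).factorial : ℝ) ≤ 4 ^ k * (k.factorial * k.factorial) := by
      have e3 := Nat.choose_mul_factorial_mul_factorial (show k ≤ 2 * k by omega)
      have e4 : (2 * k).choose k ≤ 2 ^ (2 * k) := Nat.choose_le_two_pow _ _
      rw [show 2 * k - k = k by omega] at e3
      rw [pow_mul] at e4
      have : (2 * k).factorial ≤ 4 ^ k * (k.factorial * k.factorial) := by
        rw [← e3, mul_assoc]
        exact Nat.mul_le_mul_right _ (by simpa using e4)
      exact_mod_cast this
    rw [div_pow, ← pow_mul, div_div, div_div]
    refine div_le_div_of_nonneg_left (by positivity) (by positivity) ?_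
    calc ((2 * k).factorial * ν.factorial : ℝ)
        ≤ 4 ^ k * (k.factorial * k.factorial) * ν.factorial := by gcongr
      _ = 4 ^ k * (k.factorial * (ν.factorial * k.factorial)) := by ring
      _ ≤ _ := by gcongr
  refine h2.trans ?_
  gcongr
  rw [Real.cosh_eq]
  have : Real.exp (-x) ≤ Real.exp x := Real.exp_le_exp.2 (by linarith)
  linarith

/-! ### The Marcum integrand and the recurrence in the order -/

/-- The integrand of the generalized Marcum function. -/
noncomputable def marcumKernel (n : ℤ) (α x : ℝ) : ℝ :=
  x ^ n / α ^ (n - 1) * Real.exp (-(α ^ 2 + x ^ 2) / 2) * besselI (n - 1) (α * x)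

/-- The increment of the generalized Marcum function when its order grows from `n` to `n + 1`. -/
noncomputable def marcumStep (n : ℤ) (α x : ℝ) : ℝ :=
  (x / α) ^ n * Real.exp (-(α ^ 2 + x ^ 2) / 2) * besselI n (α * x)

lemma besselI_neg (n : ℤ) (x : ℝ) : besselI (-n) x = besselI n x := by
  simp [besselI]

lemma marcumKernel_add_one (n : ℤ) (α : ℝ) {x : ℝ} (hx : x ≠ 0) :
    marcumKernel (n + 1) α x = x * marcumStep n α x := by
  rw [marcumKernel, marcumStep, add_sub_cancel_right, zpow_add_one₀ hx, div_zpow]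
  ring

/-- The source of the reflection formula: the Bessel function is even in its order, and the rest is
symmetric up to inverting `x / α`. -/
lemma marcumStep_neg_swap (n : ℤ) (α x : ℝ) :
    marcumStep (-n) α x = marcumStep n x α := by
  rw [marcumStep, marcumStep, besselI_neg, zpow_neg, ← inv_zpow, inv_div, mul_comm α x,
    add_comm (α ^ 2)]

lemma marcumKernel_natCast_add_one (k : ℕ) {α : ℝ} (hα : α ≠ 0) (x : ℝ) :
    marcumKernel (k + 1) α x = x ^ (2 * k + 1) / 2 ^ k *
      (besselSeries k ((α * x) ^ 2 / 4) * Real.exp (-(α ^ 2 + x ^ 2) / 2)) := by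
  rw [marcumKernel, besselI_eq, add_sub_cancel_right, Int.natAbs_natCast, zpow_natCast,
    show ((k : ℤ) + 1) = ((k + 1 : ℕ) : ℤ) by push_cast; rfl, zpow_natCast, div_pow, mul_pow]
  field_simp
  ring

lemma marcumKernel_neg_natCast (k : ℕ) (α : ℝ) {x : ℝ} (hx : x ≠ 0) :
    marcumKernel (-k) α x = (α ^ 2 / 2) ^ (k + 1) *
      (x * (besselSeries (k + 1) ((α * x) ^ 2 / 4) * Real.exp (-(α ^ 2 + x ^ 2) / 2))) := by
  rw [marcumKernel, besselI_eq, show (-(k : ℤ) - 1) = -((k + 1 : ℕ) : ℤ) by push_cast; ring,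
    Int.natAbs_neg, Int.natAbs_natCast, zpow_neg, zpow_neg, zpow_natCast, zpow_natCast, div_pow,
    div_pow, mul_pow]
  field_simp
  ring

lemma marcumStep_natCast (k : ℕ) {α : ℝ} (hα : α ≠ 0) (x : ℝ) :
    marcumStep k α x = x ^ (2 * k) / 2 ^ k *
      (besselSeries k ((α * x) ^ 2 / 4) * Real.exp (-(α ^ 2 + x ^ 2) / 2)) := by
  rw [marcumStep, besselI_eq, Int.natAbs_natCast, zpow_natCast, div_pow, div_pow, mul_pow]
  field_simp
  ring

lemma marcumStep_neg_natCast (k : ℕ) (α : ℝ) {x : ℝ} (hx : x ≠ 0) :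
    marcumStep (-k) α x = (α ^ 2 / 2) ^ k *
      (besselSeries k ((α * x) ^ 2 / 4) * Real.exp (-(α ^ 2 + x ^ 2) / 2)) := by
  rw [marcumStep_neg_swap, marcumStep_natCast k hx, pow_mul, div_pow, mul_comm α x,
    add_comm (α ^ 2)]

/-- In each of these cases the kernel on `x > 0` is a monomial in `x` times an entire function, with
no negative power of `x`. -/
lemma int_cases_marcum (n : ℤ) : (∃ k : ℕ, n = k + 1) ∨ ∃ k : ℕ, n = -k := by
  rcases le_or_gt n 0 with h | h
  · exact .inr ⟨(-n).toNat, by omega⟩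
  · exact .inl ⟨(n - 1).toNat, by omega⟩

/-- Completing the square in the exponent. The rate 2 is chosen so that a polynomial factor, bounded
by a multiple of `exp x`, still leaves `exp (-x)`. -/
lemma besselSeries_mul_exp_le (k : ℕ) {α x : ℝ} (hα : 0 ≤ α) (hx : 0 ≤ x) :
    besselSeries k ((α * x) ^ 2 / 4) * Real.exp (-(α ^ 2 + x ^ 2) / 2) ≤
      Real.exp ((α + 2) ^ 2 / 2) / k.factorial * Real.exp (-2 * x) := by
  calc _ ≤ Real.exp (α * x) / k.factorial * Real.exp (-(α ^ 2 + x ^ 2) / 2) := by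
        gcongr
        exact besselSeries_le k (by positivity)
    _ = Real.exp (α * x + -(α ^ 2 + x ^ 2) / 2) / k.factorial := by
        rw [Real.exp_add]; ring
    _ ≤ Real.exp ((α + 2) ^ 2 / 2 + -2 * x) / k.factorial := by
        refine div_le_div_of_nonneg_right (Real.exp_le_exp.2 ?_) (by positivity)
        nlinarith [sq_nonneg (x - (α + 2)), sq_nonneg α]
    _ = _ := by rw [Real.exp_add]; ring

lemma besselSeries_mul_exp_nonneg (k : ℕ) (α x : ℝ) :
    0 ≤ besselSeries k ((α * x) ^ 2 / 4) * Real.exp (-(α ^ 2 + x ^ 2) / 2) :=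
  mul_nonneg (besselSeries_nonneg _ (by positivity)) (Real.exp_pos _).le

lemma marcumKernel_nonneg (n : ℤ) {α x : ℝ} (hα : 0 < α) (hx : 0 < x) :
    0 ≤ marcumKernel n α x := by
  have := besselSeries_mul_exp_nonneg
  rcases int_cases_marcum n with ⟨k, rfl⟩ | ⟨k, rfl⟩
  · rw [marcumKernel_natCast_add_one k hα.ne']
    have := this k α x
    positivity
  · rw [marcumKernel_neg_natCast k α hx.ne']
    have := this (k + 1) α x
    positivity

lemma marcumKernel_neg_natCast_le (k : ℕ) {α x : ℝ} (hα : 0 < α) (hx : 0 < x) :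
    marcumKernel (-k) α x ≤ (α ^ 2 / 2) ^ (k + 1) / (k + 1).factorial *
      (Real.exp ((α + 2) ^ 2 / 2) * Real.exp (-x)) := by
  have h1 := besselSeries_mul_exp_le (k + 1) hα.le hx.le
  have h2 := besselSeries_mul_exp_nonneg (k + 1) α x
  have h3 : x ≤ Real.exp x := by linarith [Real.add_one_le_exp x]
  rw [marcumKernel_neg_natCast k α hx.ne']
  calc _ ≤ (α ^ 2 / 2) ^ (k + 1) * (Real.exp x *
          (Real.exp ((α + 2) ^ 2 / 2) / (k + 1).factorial * Real.exp (-2 * x))) := by gcongr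
    _ = _ := by
        rw [show -x = x + -2 * x by ring, Real.exp_add]; ring

lemma marcumKernel_le (n : ℤ) {α : ℝ} (hα : 0 < α) :
    ∃ C : ℝ, ∀ x, 0 < x → marcumKernel n α x ≤ C * Real.exp (-x) := by
  rcases int_cases_marcum n with ⟨k, rfl⟩ | ⟨k, rfl⟩
  · refine ⟨(2 * k + 1).factorial / 2 ^ k * (Real.exp ((α + 2) ^ 2 / 2) / k.factorial),
      fun x hx => ?_⟩
    have h1 := besselSeries_mul_exp_le k hα.le hx.le
    have h2 := besselSeries_mul_exp_nonneg k α x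
    have h3 := Real.pow_div_factorial_le_exp x hx.le (2 * k + 1)
    rw [div_le_iff₀ (by positivity)] at h3
    rw [marcumKernel_natCast_add_one k hα.ne']
    calc _ ≤ Real.exp x * (2 * k + 1).factorial / 2 ^ k *
            (Real.exp ((α + 2) ^ 2 / 2) / k.factorial * Real.exp (-2 * x)) := by gcongr
      _ = _ := by
          rw [show -x = x + -2 * x by ring, Real.exp_add]; ring
  · exact ⟨_, fun x hx => by
      have := marcumKernel_neg_natCast_le k hα hx
      rwa [← mul_assoc] at this⟩

lemma continuousOn_marcumKernel (n : ℤ) {α : ℝ} (hα : 0 < α) :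
    ContinuousOn (marcumKernel n α) (Set.Ioi 0) := by
  have hB := continuous_besselSeries
  rcases int_cases_marcum n with ⟨k, rfl⟩ | ⟨k, rfl⟩
  · refine Continuous.continuousOn ?_
    rw [funext (marcumKernel_natCast_add_one k hα.ne')]
    have := hB k
    fun_prop
  · refine ContinuousOn.congr (Continuous.continuousOn ?_)
      fun x hx => marcumKernel_neg_natCast k α (ne_of_gt hx)
    have := hB (k + 1)
    fun_prop

lemma continuous_marcumKernel_natCast_add_one (k : ℕ) {α : ℝ} (hα : 0 < α) :
    Continuous (marcumKernel (k + 1) α) := by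
  rw [funext (marcumKernel_natCast_add_one k hα.ne')]
  have := continuous_besselSeries k
  fun_prop

lemma integrableOn_marcumKernel (n : ℤ) {α β : ℝ} (hα : 0 < α) (hβ : 0 ≤ β) :
    IntegrableOn (marcumKernel n α) (Set.Ioi β) := by
  obtain ⟨C, hC⟩ := marcumKernel_le n hα
  have hsub : Set.Ioi β ⊆ Set.Ioi 0 := Set.Ioi_subset_Ioi hβ
  refine Integrable.mono' (g := fun x => C * Real.exp (-x)) ?_
    ((continuousOn_marcumKernel n hα).mono hsub |>.aestronglyMeasurable measurableSet_Ioi) ?_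
  · have := (integrableOn_exp_neg_Ioi β).const_mul C
    exact this
  · filter_upwards [ae_restrict_mem measurableSet_Ioi] with x hx
    rw [Real.norm_of_nonneg (marcumKernel_nonneg n hα (hsub hx))]
    exact hC x (hsub hx)

lemma marcumQ_eq (n : ℤ) (α β : ℝ) :
    marcumQ n α β = ∫ x in Set.Ioi β, marcumKernel n α x := rfl

lemma marcumQ_nonneg (n : ℤ) {α β : ℝ} (hα : 0 < α) (hβ : 0 ≤ β) : 0 ≤ marcumQ n α β :=
  setIntegral_nonneg measurableSet_Ioi fun _ hx => marcumKernel_nonneg n hα (hβ.trans_lt hx)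

lemma marcumQ_le (n : ℤ) {α : ℝ} (hα : 0 < α) :
    ∃ C : ℝ, ∀ β, 0 ≤ β → marcumQ n α β ≤ C * Real.exp (-β) := by
  obtain ⟨C, hC⟩ := marcumKernel_le n hα
  refine ⟨C, fun β hβ => ?_⟩
  rw [← integral_exp_neg_Ioi β, ← integral_const_mul, marcumQ_eq]
  refine setIntegral_mono_on (integrableOn_marcumKernel n hα hβ)
    ((integrableOn_exp_neg_Ioi β).const_mul C) measurableSet_Ioi
    fun x hx => hC x (hβ.trans_lt hx)

/-- Integrating this identity gives the recurrence in the order for every kind of Marcum integral.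
For positive `n` it uses the Bessel recurrence; for `n ≤ 0` the power of `x` cancels and the product
rule suffices. -/
lemma hasDerivAt_marcumStep (n : ℤ) {α x : ℝ} (hα : 0 < α) (hx : 0 < x) :
    HasDerivAt (marcumStep n α) (marcumKernel n α x - marcumKernel (n + 1) α x) x := by
  have hE : HasDerivAt (fun x : ℝ => Real.exp (-(α ^ 2 + x ^ 2) / 2))
      (-x * Real.exp (-(α ^ 2 + x ^ 2) / 2)) x := by
    have h1 : HasDerivAt (fun x : ℝ => -(α ^ 2 + x ^ 2) / 2) (-x) x :=
      (((hasDerivAt_pow 2 x).const_add (α ^ 2)).fun_neg.div_const 2).congr_deriv (by simp; ring)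
    exact h1.exp.congr_deriv (mul_comm _ _)
  have hB (k : ℕ) : HasDerivAt (fun x : ℝ => besselSeries k ((α * x) ^ 2 / 4))
      (α ^ 2 * x / 2 * besselSeries (k + 1) ((α * x) ^ 2 / 4)) x := by
    have h1 : HasDerivAt (fun x : ℝ => (α * x) ^ 2 / 4) (α ^ 2 * x / 2) x :=
      (((hasDerivAt_id' x).const_mul α).fun_pow 2).div_const 4 |>.congr_deriv (by simp; ring)
    exact ((hasDerivAt_besselSeries k _).comp x h1).congr_deriv (mul_comm _ _)
  rw [marcumKernel_add_one n α hx.ne']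
  rcases int_cases_marcum n with ⟨k, rfl⟩ | ⟨k, rfl⟩
  · rw [marcumKernel_natCast_add_one k hα.ne',
      show ((k : ℤ) + 1) = ((k + 1 : ℕ) : ℤ) by push_cast; rfl,
      funext (marcumStep_natCast (k + 1) hα.ne')]
    refine (((hasDerivAt_pow (2 * (k + 1)) x).div_const _).fun_mul ((hB (k + 1)).fun_mul hE)).congr_deriv ?_
    rw [← besselSeries_recurrence k, show 2 * (k + 1) - 1 = 2 * k + 1 by omega]
    push_cast
    field_simp
    ring
  · rw [marcumKernel_neg_natCast k α hx.ne', marcumStep_neg_natCast k α hx.ne']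
    have h := (((hB k).fun_mul hE).const_mul ((α ^ 2 / 2) ^ k))
    refine (h.congr_of_eventuallyEq ?_).congr_deriv ?_
    · filter_upwards [lt_mem_nhds hx] with y hy
      exact marcumStep_neg_natCast k α hy.ne'
    · ring

lemma tendsto_marcumStep (n : ℤ) {α : ℝ} (hα : 0 < α) :
    Filter.Tendsto (marcumStep n α) Filter.atTop (nhds 0) := by
  obtain ⟨C, hC⟩ := marcumKernel_le (n + 1) hα
  have h1 : Filter.Tendsto (fun x : ℝ => C * Real.exp (-x)) Filter.atTop (nhds 0) := by
    simpa using (Real.tendsto_exp_neg_atTop_nhds_zero).const_mul C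
  refine tendsto_of_tendsto_of_tendsto_of_le_of_le' tendsto_const_nhds h1 ?_ ?_
  · filter_upwards [Filter.eventually_ge_atTop 1] with x hx
    have h0 : 0 < x := by linarith
    have := marcumKernel_nonneg (n + 1) hα h0
    rw [marcumKernel_add_one n α h0.ne'] at this
    exact nonneg_of_mul_nonneg_right this h0
  · filter_upwards [Filter.eventually_ge_atTop 1] with x hx
    have h0 : 0 < x := by linarith
    have h2 := marcumKernel_nonneg (n + 1) hα h0
    have h3 := hC x h0
    rw [marcumKernel_add_one n α h0.ne'] at h2 h3
    nlinarith [nonneg_of_mul_nonneg_right h2 h0]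

lemma marcumQ_add_one (n : ℤ) {α β : ℝ} (hα : 0 < α) (hβ : 0 < β) :
    marcumQ (n + 1) α β = marcumQ n α β + marcumStep n α β := by
  have h := integral_Ioi_of_hasDerivAt_of_tendsto' (a := β)
    (fun x hx => hasDerivAt_marcumStep n hα (hβ.trans_le hx))
    ((integrableOn_marcumKernel n hα hβ.le).sub (integrableOn_marcumKernel (n + 1) hα hβ.le))
    (tendsto_marcumStep n hα)
  rw [integral_sub (integrableOn_marcumKernel n hα hβ.le)
    (integrableOn_marcumKernel (n + 1) hα hβ.le), ← marcumQ_eq, ← marcumQ_eq] at h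
  linarith

/-! ### Reflection formula and derivative in the second argument -/

/-- The complementary Marcum function of order `k + 1`. -/
noncomputable def marcumP (k : ℕ) (α β : ℝ) : ℝ := ∫ x in (0 : ℝ)..β, marcumKernel (k + 1) α x

lemma marcumP_eq_add (k : ℕ) {α β : ℝ} (hα : 0 < α) (hβ : 0 < β) :
    marcumP k α β = marcumP (k + 1) α β + marcumStep (k + 1) α β := by
  have hi (j : ℕ) : IntervalIntegrable (marcumKernel (j + 1) α) volume 0 β :=
    (continuous_marcumKernel_natCast_add_one j hα).intervalIntegrable _ _
  have hi' : IntervalIntegrable (marcumKernel (k + 1 + 1) α) volume 0 β := by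
    exact_mod_cast hi (k + 1)
  have hc : Continuous (marcumStep (k + 1) α) := by
    rw [show ((k : ℤ) + 1) = ((k + 1 : ℕ) : ℤ) by push_cast; rfl,
      funext (marcumStep_natCast (k + 1) hα.ne')]
    have := continuous_besselSeries (k + 1)
    fun_prop
  have h0 : marcumStep (k + 1) α 0 = 0 := by
    rw [show ((k : ℤ) + 1) = ((k + 1 : ℕ) : ℤ) by push_cast; rfl, marcumStep_natCast _ hα.ne']
    simp
  have h := intervalIntegral.integral_eq_sub_of_hasDerivAt_of_le hβ.le hc.continuousOn
    (fun x hx => hasDerivAt_marcumStep (k + 1) hα hx.1) ((hi k).sub hi')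
  rw [intervalIntegral.integral_sub (hi k) hi', h0] at h
  simp only [marcumP]
  push_cast
  linarith

lemma tendsto_marcumP {α β : ℝ} (hα : 0 < α) (hβ : 0 < β) :
    Filter.Tendsto (fun k => marcumP k α β) Filter.atTop (nhds 0) := by
  have h1 : Filter.Tendsto (fun k : ℕ => (β ^ 2 / 2) ^ k / k.factorial *
      (β * Real.exp ((α + 2) ^ 2 / 2)) * β) Filter.atTop (nhds 0) := by
    simpa using ((FloorSemiring.tendsto_pow_div_factorial_atTop (β ^ 2 / 2)).mul_const
      (β * Real.exp ((α + 2) ^ 2 / 2))).mul_const β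
  refine squeeze_zero (fun k => ?_) (fun k => ?_) h1
  · refine intervalIntegral.integral_nonneg hβ.le fun x hx => ?_
    rw [marcumKernel_natCast_add_one k hα.ne']
    have := besselSeries_mul_exp_nonneg k α x
    have := hx.1
    positivity
  · refine (Real.le_norm_self _).trans ((intervalIntegral.norm_integral_le_of_norm_le_const
      (C := (β ^ 2 / 2) ^ k / k.factorial * (β * Real.exp ((α + 2) ^ 2 / 2)))
      fun x hx => ?_).trans_eq ?_)
    · rw [Set.uIoc_of_le hβ.le] at hx
      have h2 := besselSeries_mul_exp_nonneg k α x
      have h3 := besselSeries_mul_exp_le k hα.le hx.1.le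
      have h4 : Real.exp (-2 * x) ≤ 1 := Real.exp_le_one_iff.2 (by linarith [hx.1])
      rw [Real.norm_of_nonneg (marcumKernel_nonneg _ hα hx.1), marcumKernel_natCast_add_one k hα.ne']
      calc _ ≤ β ^ (2 * k + 1) / 2 ^ k * (Real.exp ((α + 2) ^ 2 / 2) / k.factorial * 1) := by
            have := hx.1.le
            have := hx.2
            refine mul_le_mul (by gcongr) (h3.trans (by gcongr)) h2 (by positivity)
        _ = _ := by rw [pow_succ, pow_mul, div_pow]; ring
    · rw [sub_zero, abs_of_pos hβ]

lemma tendsto_marcumQ_neg {α β : ℝ} (hα : 0 < α) (hβ : 0 < β) :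
    Filter.Tendsto (fun k : ℕ => marcumQ (-k) α β) Filter.atTop (nhds 0) := by
  have h1 : Filter.Tendsto (fun k : ℕ => (α ^ 2 / 2) ^ (k + 1) / (k + 1).factorial *
      (Real.exp ((α + 2) ^ 2 / 2) * Real.exp (-β))) Filter.atTop (nhds 0) := by
    simpa using (((Filter.tendsto_add_atTop_iff_nat 1).2
      (FloorSemiring.tendsto_pow_div_factorial_atTop (α ^ 2 / 2))).mul_const
      (Real.exp ((α + 2) ^ 2 / 2) * Real.exp (-β)))
  refine squeeze_zero (fun k => marcumQ_nonneg _ hα hβ.le) (fun k => ?_) h1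
  rw [← integral_exp_neg_Ioi β, ← integral_const_mul, ← integral_const_mul, marcumQ_eq]
  exact setIntegral_mono_on (integrableOn_marcumKernel _ hα hβ.le)
    (((integrableOn_exp_neg_Ioi β).const_mul _).const_mul _) measurableSet_Ioi
    fun x hx => marcumKernel_neg_natCast_le k hα (hβ.trans hx)

/-- The reflection formula `1 - Q_{k+1}(α, β) = Q_{-k}(β, α)`. -/
lemma marcumP_eq_marcumQ (k : ℕ) {α β : ℝ} (hα : 0 < α) (hβ : 0 < β) :
    marcumP k α β = marcumQ (-k) β α := by
  -- Both sides drop by the same `marcumStep` when `k` grows by 1, so their difference does not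
  -- depend on `k`. Both tend to 0, so the difference vanishes; the total mass of the kernel is
  -- never needed.
  have hconst (j : ℕ) : marcumP (k + j) α β - marcumQ (-(k + j : ℕ)) β α =
      marcumP k α β - marcumQ (-k) β α := by
    induction j with
    | zero => simp
    | succ j ih =>
      rw [← ih, ← add_assoc, marcumP_eq_add (k + j) hα hβ]
      have h := marcumQ_add_one (-((k + j : ℕ) : ℤ) - 1) hβ hα
      rw [sub_add_cancel, show (-((k + j : ℕ) : ℤ) - 1) = -(((k + j : ℕ) : ℤ) + 1) by ring,
        marcumStep_neg_swap] at h
      rw [h]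
      push_cast
      ring
  have hl : Filter.Tendsto (fun j => marcumP (k + j) α β - marcumQ (-(k + j : ℕ)) β α)
      Filter.atTop (nhds (0 - 0)) := by
    have ht : Filter.Tendsto (fun j => k + j) Filter.atTop Filter.atTop := by
      simpa only [add_comm] using Filter.tendsto_add_atTop_nat k
    exact ((tendsto_marcumP hα hβ).comp ht).sub ((tendsto_marcumQ_neg hβ hα).comp ht)
  simp only [hconst] at hl
  have := tendsto_nhds_unique hl tendsto_const_nhds
  linarith

lemma hasDerivAt_marcumQ (n : ℤ) {α β : ℝ} (hα : 0 < α) (hβ : 0 < β) :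
    HasDerivAt (marcumQ n α) (-marcumKernel n α β) β := by
  -- The base point `β / 2` stays away from 0, where continuity of the kernel is not available for
  -- all orders.
  have hsplit : ∀ᶠ x in nhds β, marcumQ n α x =
      marcumQ n α (β / 2) - ∫ y in (β / 2)..x, marcumKernel n α y := by
    filter_upwards [lt_mem_nhds (half_lt_self hβ)] with x hx
    have := intervalIntegral.integral_Ioi_sub_Ioi
      (integrableOn_marcumKernel n hα (half_pos hβ).le) hx.le
    rw [← this]
    simp only [marcumQ_eq]
    ring
  have hc : ContinuousAt (marcumKernel n α) β :=
    (continuousOn_marcumKernel n hα).continuousAt (Ioi_mem_nhds hβ)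
  have hi : IntervalIntegrable (marcumKernel n α) volume (β / 2) β := by
    refine ((continuousOn_marcumKernel n hα).mono fun x hx => ?_).intervalIntegrable
    rw [Set.uIcc_of_le (half_lt_self hβ).le] at hx
    exact (half_pos hβ).trans_le hx.1
  have := intervalIntegral.integral_hasDerivAt_right hi
    ((continuousOn_marcumKernel n hα).stronglyMeasurableAtFilter isOpen_Ioi β hβ) hc
  exact (this.const_sub _).congr_of_eventuallyEq hsplit

/-! ### Collapse of the triple sum -/

/-- When `u > i` one of the factors is 0; this decides which terms of `coeffA` survive. -/
lemma poch_natCast_add_one_sub (i u : ℕ) :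
    poch ((i : ℝ) + 1 - u) u =
      if u ≤ i then (i.factorial : ℝ) / ((i - u).factorial : ℝ) else 0 := by
  split_ifs with h
  · obtain ⟨v, rfl⟩ := Nat.exists_eq_add_of_le' h
    rw [poch, Nat.add_sub_cancel, show ((v + u : ℕ) : ℝ) + 1 - u = ((v + 1 : ℕ) : ℝ) by
      push_cast; ring, eq_div_iff (by positivity), ← Nat.cast_ascFactorial, mul_comm]
    exact_mod_cast Nat.factorial_mul_ascFactorial v u
  · rw [poch, ascPochhammer_eval_eq_zero_iff]
    refine ⟨u - (i + 1), by omega, ?_⟩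
    rw [Nat.cast_sub (by omega)]
    push_cast
    ring

lemma coeffA_eq (r i k : ℕ) (z : ℝ) :
    coeffA r (i + 1) ((k : ℝ) + ((i + 1 : ℕ) : ℝ)) z =
      ∑ j ∈ Finset.range (r / 2 + 1), if r - j ≤ i then
        (-1) ^ (i + j) * poch ((k + (i - (r - j)) : ℕ) : ℝ) (r - 2 * j) /
          (((i - (r - j)).factorial : ℝ) * (r - 2 * j).factorial * j.factorial) * z ^ j else 0 := by
  rw [coeffA, Finset.mul_sum]
  refine Finset.sum_congr rfl fun j hj => ?_
  have hj' : j ≤ r := by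
    have := Finset.mem_range.1 hj
    omega
  have e1 : (((i + 1 : ℕ) : ℝ) - r + j) = (i : ℝ) + 1 - ((r - j : ℕ) : ℝ) := by
    rw [Nat.cast_sub hj']
    push_cast
    ring
  rw [e1, poch_natCast_add_one_sub, Nat.add_sub_cancel]
  split_ifs with h
  · have e2 : ((k : ℝ) + ((i + 1 : ℕ) : ℝ) - r - 1 + j) = ((k + (i - (r - j)) : ℕ) : ℝ) := by
      rw [Nat.cast_add k, Nat.cast_sub h, Nat.cast_sub hj', Nat.cast_add_one]
      ring
    rw [e2, pow_add]
    field_simp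
  · simp

/-- The new indices are `w = r - 2j` and `N = k + (i - (r - j))`. In the application the summand
depends on `k` at fixed `N` only through `(-1) ^ (N - k) / (k! (N - k)!)`, so `k` must be innermost.
-/
lemma sum_reindex (m : ℕ) (G : ℕ → ℕ → ℕ → ℕ → ℝ) :
    (∑ k ∈ Finset.range m, ∑ i ∈ Finset.range (m - k), ∑ r ∈ Finset.range (2 * i + 1),
      ∑ j ∈ Finset.range (r / 2 + 1),
        if r - j ≤ i then G j (r - 2 * j) k (i - (r - j)) else 0) =
    ∑ j ∈ Finset.range m, ∑ w ∈ Finset.range (m - j), ∑ N ∈ Finset.range (m - j - w),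
      ∑ k ∈ Finset.range (N + 1), G j w k (N - k) := by
  simp only [← Finset.sum_filter]
  simp only [Finset.sum_sigma']
  refine Finset.sum_bij'
    (fun x _ => ⟨x.2.2.2, x.2.2.1 - 2 * x.2.2.2, x.1 + (x.2.1 - (x.2.2.1 - x.2.2.2)), x.1⟩)
    (fun x _ => ⟨x.2.2.2, x.2.2.1 - x.2.2.2 + x.2.1 + x.1, x.2.1 + 2 * x.1, x.1⟩)
    ?_ ?_ ?_ ?_ ?_
  · rintro ⟨k, i, r, j⟩ h
    simp only [Finset.mem_sigma, Finset.mem_range, Finset.mem_filter] at h ⊢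
    omega
  · rintro ⟨j, w, N, k⟩ h
    simp only [Finset.mem_sigma, Finset.mem_range, Finset.mem_filter] at h ⊢
    omega
  · rintro ⟨k, i, r, j⟩ h
    simp only [Finset.mem_sigma, Finset.mem_range, Finset.mem_filter] at h
    simp only [Sigma.mk.injEq, heq_eq_eq, and_true, true_and]
    omega
  · rintro ⟨j, w, N, k⟩ h
    simp only [Finset.mem_sigma, Finset.mem_range] at h
    simp only [Sigma.mk.injEq, heq_eq_eq, and_true, true_and]
    omega
  · rintro ⟨k, i, r, j⟩ h
    simp only [Nat.add_sub_cancel_left]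

lemma sum_neg_one_pow_div_factorial (N : ℕ) :
    ∑ k ∈ Finset.range (N + 1), (-1 : ℝ) ^ (N - k) / (k.factorial * (N - k).factorial) =
      if N = 0 then 1 else 0 := by
  have h := add_pow (1 : ℝ) (-1) N
  rw [add_neg_cancel] at h
  have h2 : ∑ k ∈ Finset.range (N + 1), (-1 : ℝ) ^ (N - k) / (k.factorial * (N - k).factorial) =
      (0 : ℝ) ^ N / N.factorial := by
    rw [h, Finset.sum_div]
    refine Finset.sum_congr rfl fun k hk => ?_
    rw [Nat.cast_choose ℝ (Finset.mem_range_succ_iff.1 hk)]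
    field_simp
    simp
  rw [h2]
  split_ifs with h0 <;> simp [h0]

lemma sum_Icc_one (n : ℕ) (f : ℕ → ℝ) :
    ∑ i ∈ Finset.Icc 1 n, f i = ∑ i ∈ Finset.range n, f (i + 1) := by
  rw [← Finset.Ico_add_one_right_eq_Icc, Finset.sum_Ico_eq_sum_range, Nat.add_sub_cancel]
  simp only [add_comm]

/-- After regrouping, the sum over `k` is a multiple of `(1 - 1) ^ N`, which forces `N = 0`; then
the Pochhammer symbol at 0 forces `w = 0`, leaving one term for each `j`. Nothing about `F` is used.
-/
lemma sum_coeffA (m : ℕ) {q T : ℝ} (hT : T ≠ 0) (z : ℝ) (F : ℤ → ℝ) :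
    ∑ k ∈ Finset.range m, ∑ i ∈ Finset.Icc 1 (m - k), ∑ r ∈ Finset.range (2 * (i - 1) + 1),
        q ^ r / (k.factorial : ℝ) * T ^ ((k : ℤ) + (i : ℤ) - (r : ℤ) - 1) *
          coeffA r i ((k : ℝ) + (i : ℝ)) z * F (2 - (k : ℤ) - (i : ℤ) + (r : ℤ)) =
      ∑ j ∈ Finset.range m, (q ^ 2 * z / T) ^ j / (j.factorial : ℝ) * F (1 + j) := by
  have hG := sum_reindex m fun j w k v =>
    (q ^ (w + 2 * j) * T ^ (((k + v : ℕ) : ℤ) - j) * z ^ j * (-1) ^ w *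
      poch ((k + v : ℕ) : ℝ) w / ((w.factorial : ℝ) * j.factorial) *
      F (1 - ((k + v : ℕ) : ℤ) + j)) * ((-1) ^ v / ((k.factorial : ℝ) * v.factorial))
  calc _ = _ := ?_
    _ = _ := hG
    _ = _ := ?_
  · refine Finset.sum_congr rfl fun k _ => ?_
    rw [sum_Icc_one]
    refine Finset.sum_congr rfl fun i _ => ?_
    rw [Nat.add_sub_cancel]
    refine Finset.sum_congr rfl fun r _ => ?_
    rw [coeffA_eq, Finset.mul_sum, Finset.sum_mul]
    refine Finset.sum_congr rfl fun j hj => ?_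
    have hj' : 2 * j ≤ r := by
      have := Finset.mem_range.1 hj
      omega
    split_ifs with h
    · obtain ⟨w, rfl⟩ := Nat.exists_eq_add_of_le' hj'
      rw [show w + 2 * j - j = w + j by omega] at h ⊢
      obtain ⟨v, rfl⟩ := Nat.exists_eq_add_of_le' h
      rw [Nat.add_sub_cancel, Nat.add_sub_cancel,
        show ((k : ℤ) + ((v + (w + j) + 1 : ℕ) : ℤ) - ((w + 2 * j : ℕ) : ℤ) - 1) =
          ((k + v : ℕ) : ℤ) - j by push_cast; ring,
        show (2 - (k : ℤ) - ((v + (w + j) + 1 : ℕ) : ℤ) + ((w + 2 * j : ℕ) : ℤ)) =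
          1 - ((k + v : ℕ) : ℤ) + j by push_cast; ring,
        show v + (w + j) + j = v + w + (j + j) by ring, pow_add (-1 : ℝ) (v + w),
        Even.neg_one_pow ⟨j, rfl⟩]
      field_simp
      ring
    · simp
  · refine Finset.sum_congr rfl fun j hj => ?_
    have hj' := Finset.mem_range.1 hj
    have hin (w N : ℕ) : ∑ k ∈ Finset.range (N + 1),
        (q ^ (w + 2 * j) * T ^ (((k + (N - k) : ℕ) : ℤ) - j) * z ^ j * (-1) ^ w *
        poch ((k + (N - k) : ℕ) : ℝ) w / ((w.factorial : ℝ) * j.factorial) *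
        F (1 - ((k + (N - k) : ℕ) : ℤ) + j)) *
          ((-1) ^ (N - k) / ((k.factorial : ℝ) * (N - k).factorial)) =
        if N = 0 then q ^ (w + 2 * j) * T ^ (-(j : ℤ)) * z ^ j * (-1) ^ w *
          poch 0 w / ((w.factorial : ℝ) * j.factorial) * F (1 + j) else 0 := by
      calc _ = (q ^ (w + 2 * j) * T ^ ((N : ℤ) - j) * z ^ j * (-1) ^ w *
            poch (N : ℝ) w / ((w.factorial : ℝ) * j.factorial) * F (1 - (N : ℤ) + j)) *
            if N = 0 then 1 else 0 := by
            rw [← sum_neg_one_pow_div_factorial, Finset.mul_sum]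
            refine Finset.sum_congr rfl fun k hk => ?_
            rw [Nat.add_sub_of_le (Finset.mem_range_succ_iff.1 hk)]
        _ = _ := by
            split_ifs with h
            · simp [h]
            · simp
    simp only [hin]
    have hw : ∀ w ∈ Finset.range (m - j), (∑ N ∈ Finset.range (m - j - w),
        if N = 0 then q ^ (w + 2 * j) * T ^ (-(j : ℤ)) * z ^ j * (-1) ^ w *
          poch 0 w / ((w.factorial : ℝ) * j.factorial) * F (1 + j) else 0) =
        q ^ (w + 2 * j) * T ^ (-(j : ℤ)) * z ^ j * (-1) ^ w *
          poch 0 w / ((w.factorial : ℝ) * j.factorial) * F (1 + j) := fun w hw => by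
      have := Finset.mem_range.1 hw
      rw [Finset.sum_ite_eq' , if_pos (Finset.mem_range.2 (by omega))]
    -- `poch 0 w` vanishes unless `w = 0`.
    rw [Finset.sum_congr rfl hw, Finset.sum_eq_single_of_mem 0 (Finset.mem_range.2 (by omega))
      fun w _ hw0 => by simp [poch, hw0]]
    simp only [poch, ascPochhammer_zero, Polynomial.eval_one, zpow_neg, zpow_natCast, zero_add,
      pow_zero, Nat.factorial_zero, Nat.cast_one, div_pow, mul_pow, pow_mul]
    field_simp

/-! ### The antiderivative of the tail -/

/-- The Nakagami density of shape `N + 1` and rate `A`. -/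
noncomputable def nakagamiPDF (N : ℕ) (A x : ℝ) : ℝ :=
  2 * A ^ (N + 1) / (N.factorial : ℝ) * x ^ (2 * N + 1) * Real.exp (-(A * x ^ 2))

lemma nakagamiPDF_nonneg (N : ℕ) {A x : ℝ} (hA : 0 ≤ A) (hx : 0 ≤ x) : 0 ≤ nakagamiPDF N A x := by
  rw [nakagamiPDF]
  positivity

lemma continuous_nakagamiPDF (N : ℕ) (A : ℝ) : Continuous (nakagamiPDF N A) := by
  unfold nakagamiPDF
  fun_prop

lemma tendsto_marcumQ (n : ℤ) {α : ℝ} (hα : 0 < α) :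
    Filter.Tendsto (marcumQ n α) Filter.atTop (nhds 0) := by
  obtain ⟨C, hC⟩ := marcumQ_le n hα
  have h1 : Filter.Tendsto (fun x : ℝ => C * Real.exp (-x)) Filter.atTop (nhds 0) := by
    simpa using (Real.tendsto_exp_neg_atTop_nhds_zero).const_mul C
  refine tendsto_of_tendsto_of_tendsto_of_le_of_le' tendsto_const_nhds h1 ?_ ?_
  · filter_upwards [Filter.eventually_ge_atTop 0] with x hx using marcumQ_nonneg n hα hx
  · filter_upwards [Filter.eventually_ge_atTop 0] with x hx using hC x hx

lemma hasDerivAt_marcumQ_mul (n : ℤ) {α β s : ℝ} (hα : 0 < α) (hβ : 0 < β) (hs : 0 < s) :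
    HasDerivAt (fun s => marcumQ n α (s * β)) (-(β * marcumKernel n α (s * β))) s := by
  have h := (hasDerivAt_marcumQ n hα (mul_pos hs hβ)).comp s (hasDerivAt_mul_const β)
  exact h.congr_deriv (by ring)

/-- Poisson weights have telescoping derivatives, the differences of consecutive Nakagami densities.
-/
lemma hasDerivAt_poisson_succ (c s : ℝ) (k : ℕ) :
    HasDerivAt (fun s => Real.exp (-(c * s ^ 2)) * ((c * s ^ 2) ^ (k + 1) / ((k + 1).factorial : ℝ)))
      (nakagamiPDF k c s - nakagamiPDF (k + 1) c s) s := by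
  have h1 : HasDerivAt (fun s : ℝ => c * s ^ 2) (2 * c * s) s :=
    ((hasDerivAt_pow 2 s).const_mul c).congr_deriv (by simp; ring)
  refine (h1.fun_neg.exp.fun_mul ((h1.fun_pow (k + 1)).div_const _)).congr_deriv ?_
  simp only [nakagamiPDF, Nat.factorial_succ, Nat.add_sub_cancel]
  push_cast
  field_simp
  ring

/-- Summation by parts: consecutive Marcum functions differ by a `marcumStep`, which contributes `2
* c`, while differentiating the Marcum functions contributes `β ^ 2`. Only the boundary term of
index `M` keeps a Marcum function. -/
lemma hasDerivAt_sum_poisson_mul_marcumQ (M : ℕ) (c : ℝ) {α β s : ℝ} (hα : 0 < α) (hβ : 0 < β)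
    (hs : 0 < s) :
    HasDerivAt (fun s => ∑ k ∈ Finset.range (M + 1),
        Real.exp (-(c * s ^ 2)) * ((c * s ^ 2) ^ k / (k.factorial : ℝ)) *
          marcumQ (1 - (k : ℤ)) α (s * β))
      (-(nakagamiPDF M c s * marcumQ (-M) α (s * β)) -
        (2 * c + β ^ 2) * s * ∑ k ∈ Finset.range (M + 1),
          Real.exp (-(c * s ^ 2)) * ((c * s ^ 2) ^ k / (k.factorial : ℝ)) *
            marcumStep (-k) α (s * β)) s := by
  have hsβ := mul_pos hs hβ
  induction M with
  | zero =>
    have h1 : HasDerivAt (fun s : ℝ => c * s ^ 2) (2 * c * s) s :=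
      ((hasDerivAt_pow 2 s).const_mul c).congr_deriv (by simp; ring)
    have hK := marcumKernel_add_one 0 α hsβ.ne'
    have hQ := marcumQ_add_one 0 hα hsβ
    simp only [zero_add] at hK hQ
    simp only [zero_add, Finset.range_one, Finset.sum_singleton, pow_zero, Nat.factorial_zero,
      Nat.cast_one, div_one, mul_one, Nat.cast_zero, sub_zero, neg_zero]
    refine (h1.fun_neg.exp.fun_mul (hasDerivAt_marcumQ_mul 1 hα hβ hs)).congr_deriv ?_
    rw [hK, hQ, nakagamiPDF]
    simp
    ring
  | succ M ih =>
    have hK := marcumKernel_add_one (-((M + 1 : ℕ) : ℤ)) α hsβ.ne'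
    have hQ := marcumQ_add_one (-((M + 1 : ℕ) : ℤ)) hα hsβ
    have he : (1 - ((M + 1 : ℕ) : ℤ)) = -((M + 1 : ℕ) : ℤ) + 1 := by ring
    have he' : -((M + 1 : ℕ) : ℤ) + 1 = -(M : ℤ) := by push_cast; ring
    simp only [Finset.sum_range_succ _ (M + 1)]
    refine (ih.fun_add ((hasDerivAt_poisson_succ c s M).fun_mul
      (hasDerivAt_marcumQ_mul (1 - ((M + 1 : ℕ) : ℤ)) hα hβ hs))).congr_deriv ?_
    rw [he, hK, hQ, ← he', hQ, nakagamiPDF, nakagamiPDF]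
    simp only [Nat.factorial_succ]
    push_cast
    field_simp
    ring

/-- The relation `a ^ 2 = b ^ 2 + 2 * c` is exactly what makes the Gaussian exponents agree when `s`
and `y` are exchanged. -/
lemma poisson_mul_marcumStep (k : ℕ) {a b c y s : ℝ} (hab : a ^ 2 = b ^ 2 + 2 * c)
    (ha : a ≠ 0) (hb : b ≠ 0) (hy : y ≠ 0) (hs : s ≠ 0) :
    Real.exp (-(c * s ^ 2)) * ((c * s ^ 2) ^ k / (k.factorial : ℝ)) *
        marcumStep (-k) (y * a) (s * b) =
      Real.exp (-(c * y ^ 2)) * ((c * y ^ 2) ^ k / (k.factorial : ℝ)) *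
        marcumStep k (y * b) (s * a) := by
  rw [marcumStep_neg_swap, marcumStep, marcumStep, zpow_natCast, zpow_natCast,
    show s * b * (y * a) = y * b * (s * a) by ring]
  have he : Real.exp (-(c * s ^ 2)) * Real.exp (-((s * b) ^ 2 + (y * a) ^ 2) / 2) =
      Real.exp (-(c * y ^ 2)) * Real.exp (-((y * b) ^ 2 + (s * a) ^ 2) / 2) := by
    rw [← Real.exp_add, ← Real.exp_add]
    congr 1
    linear_combination (-(y ^ 2) / 2 + s ^ 2 / 2) * hab
  have hp : (c * s ^ 2) ^ k * (y * a / (s * b)) ^ k = (c * y ^ 2) ^ k * (s * a / (y * b)) ^ k := by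
    rw [← mul_pow, ← mul_pow]
    congr 1
    field_simp
  linear_combination ((c * s ^ 2) ^ k * (y * a / (s * b)) ^ k / (k.factorial : ℝ) *
    besselI k (y * b * (s * a))) * he + (Real.exp (-(c * y ^ 2)) *
      Real.exp (-((y * b) ^ 2 + (s * a) ^ 2) / 2) / (k.factorial : ℝ) *
    besselI k (y * b * (s * a))) * hp

/-- The Marcum function expression for the probability that the first variable exceeds `s` and the
second one is at most `y`. -/
noncomputable def marcumTail (M : ℕ) (a b c y s : ℝ) : ℝ :=
  (∑ k ∈ Finset.range (M + 1), Real.exp (-(c * s ^ 2)) * ((c * s ^ 2) ^ k / (k.factorial : ℝ)) *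
      marcumQ (1 - (k : ℤ)) (y * a) (s * b)) -
    ∑ k ∈ Finset.range (M + 1), Real.exp (-(c * y ^ 2)) * ((c * y ^ 2) ^ k / (k.factorial : ℝ)) *
      marcumQ (1 + (k : ℤ)) (y * b) (s * a)

/-- The leftover steps carry the factor `(2 * c + b ^ 2) * s`, the second sum produces `a ^ 2 * s`,
and these cancel. -/
lemma hasDerivAt_marcumTail (M : ℕ) {a b c y s : ℝ} (hab : a ^ 2 = b ^ 2 + 2 * c)
    (ha : 0 < a) (hb : 0 < b) (hy : 0 < y) (hs : 0 < s) :
    HasDerivAt (marcumTail M a b c y)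
      (-(nakagamiPDF M c s * marcumQ (-M) (y * a) (s * b))) s := by
  have h2 := HasDerivAt.fun_sum (u := Finset.range (M + 1)) fun k _ =>
    (hasDerivAt_marcumQ_mul (1 + (k : ℤ)) (mul_pos hy hb) ha hs).const_mul
      (Real.exp (-(c * y ^ 2)) * ((c * y ^ 2) ^ k / (k.factorial : ℝ)))
  refine ((hasDerivAt_sum_poisson_mul_marcumQ M c (mul_pos hy ha) hb hs).fun_sub h2).congr_deriv ?_
  rw [sub_sub, sub_eq_self, Finset.mul_sum, ← Finset.sum_add_distrib]
  refine Finset.sum_eq_zero fun k _ => ?_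
  rw [add_comm 1 (k : ℤ), marcumKernel_add_one _ _ (mul_pos hs ha).ne',
    poisson_mul_marcumStep k hab ha.ne' hb.ne' hy.ne' hs.ne']
  linear_combination (-s * (Real.exp (-(c * y ^ 2)) * ((c * y ^ 2) ^ k / (k.factorial : ℝ)) *
    marcumStep k (y * b) (s * a))) * hab

lemma tendsto_marcumTail (M : ℕ) {a b c y : ℝ} (ha : 0 < a) (hb : 0 < b) (hc : 0 ≤ c)
    (hy : 0 < y) : Filter.Tendsto (marcumTail M a b c y) Filter.atTop (nhds 0) := by
  have h1 : Filter.Tendsto (fun s => ∑ k ∈ Finset.range (M + 1),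
      Real.exp (-(c * s ^ 2)) * ((c * s ^ 2) ^ k / (k.factorial : ℝ)) *
        marcumQ (1 - (k : ℤ)) (y * a) (s * b)) Filter.atTop (nhds 0) := by
    rw [← Finset.sum_const_zero (s := Finset.range (M + 1))]
    refine tendsto_finsetSum _ fun k _ => ?_
    have hq := (tendsto_marcumQ (1 - (k : ℤ)) (mul_pos hy ha)).comp
      (Filter.tendsto_id.atTop_mul_const hb)
    refine tendsto_of_tendsto_of_tendsto_of_le_of_le' tendsto_const_nhds hq ?_ ?_
    · filter_upwards [Filter.eventually_ge_atTop 0] with s hs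
      have := marcumQ_nonneg (1 - (k : ℤ)) (mul_pos hy ha) (mul_nonneg hs hb.le)
      positivity
    · filter_upwards [Filter.eventually_ge_atTop 0] with s hs
      have := marcumQ_nonneg (1 - (k : ℤ)) (mul_pos hy ha) (mul_nonneg hs hb.le)
      refine mul_le_of_le_one_left this ?_
      rw [Real.exp_neg, inv_mul_le_one₀ (Real.exp_pos _)]
      exact Real.pow_div_factorial_le_exp _ (by positivity) k
  have h2 : Filter.Tendsto (fun s => ∑ k ∈ Finset.range (M + 1),
      Real.exp (-(c * y ^ 2)) * ((c * y ^ 2) ^ k / (k.factorial : ℝ)) *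
        marcumQ (1 + (k : ℤ)) (y * b) (s * a)) Filter.atTop (nhds 0) := by
    rw [← Finset.sum_const_zero (s := Finset.range (M + 1))]
    refine tendsto_finsetSum _ fun k _ => ?_
    simpa using ((tendsto_marcumQ (1 + (k : ℤ)) (mul_pos hy hb)).comp
      (Filter.tendsto_id.atTop_mul_const ha)).const_mul
        (Real.exp (-(c * y ^ 2)) * ((c * y ^ 2) ^ k / (k.factorial : ℝ)))
  have h := h1.sub h2
  rw [sub_zero] at h
  exact h

lemma lintegral_Ioi_nakagamiPDF_mul_marcumQ (M : ℕ) {a b c y r : ℝ} (hab : a ^ 2 = b ^ 2 + 2 * c)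
    (ha : 0 < a) (hb : 0 < b) (hc : 0 ≤ c) (hy : 0 < y) (hr : 0 < r) :
    0 ≤ marcumTail M a b c y r ∧
    ∫⁻ s in Set.Ioi r, ENNReal.ofReal (nakagamiPDF M c s * marcumQ (-M) (y * a) (s * b)) =
      ENNReal.ofReal (marcumTail M a b c y r) := by
  have hd (s : ℝ) (hs : s ∈ Set.Ici r) := hasDerivAt_marcumTail M hab ha hb hy (hr.trans_le hs)
  have hpos (s : ℝ) (hs : s ∈ Set.Ioi r) :
      0 ≤ nakagamiPDF M c s * marcumQ (-M) (y * a) (s * b) :=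
    mul_nonneg (nakagamiPDF_nonneg M hc (hr.trans hs).le)
      (marcumQ_nonneg _ (mul_pos hy ha) (mul_pos (hr.trans hs) hb).le)
  have hneg (s : ℝ) (hs : s ∈ Set.Ioi r) := neg_nonpos.2 (hpos s hs)
  have hlim := tendsto_marcumTail M ha hb hc hy
  -- A derivative of constant sign with a limit at infinity is automatically integrable.
  have hint := (integrableOn_Ioi_deriv_of_nonpos' hd hneg hlim).neg
  have hval := integral_Ioi_of_hasDerivAt_of_nonpos' hd hneg hlim
  rw [integral_neg] at hval
  have hval' : ∫ s in Set.Ioi r, nakagamiPDF M c s * marcumQ (-M) (y * a) (s * b) =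
      marcumTail M a b c y r := by linarith
  constructor
  · rw [← hval']
    exact setIntegral_nonneg measurableSet_Ioi hpos
  · rw [← hval', ofReal_integral_eq_lintegral_ofReal]
    · simpa [Pi.neg_def, IntegrableOn] using hint
    · filter_upwards [ae_restrict_mem measurableSet_Ioi] with s hs using hpos s hs

/-! ### Integrating out the second variable -/

/-- Factorisation into the marginal density of the first variable and the conditional density of the
second, a rescaled Marcum kernel. -/
lemma density_eq_mul_marcumKernel (M : ℕ) {p a b s t : ℝ} (hp0 : 0 < p) (hp1 : p < 1)
    (ha : 0 < a) (ha2 : a ^ 2 = 2 * ((M + 1 : ℕ) : ℝ) / (1 - p)) (hb : b = a * √p)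
    (hs : 0 < s) (ht : 0 < t) :
    density (M + 1) 1 1 p s t =
      nakagamiPDF M ((M + 1 : ℕ) : ℝ) s * (a * marcumKernel (M + 1) (s * b) (t * a)) := by
  have hq : 0 < 1 - p := by linarith
  have hsp : 0 < √p := Real.sqrt_pos.2 hp0
  have hsp2 : √p ^ 2 = p := Real.sq_sqrt hp0.le
  have hI : 2 * ((M + 1 : ℕ) : ℝ) * √p * s * t / ((1 - p) * √(1 * 1)) = s * b * (t * a) := by
    rw [hb, one_mul, Real.sqrt_one, mul_one]
    linear_combination (-s * t * √p) * ha2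
  have hE : Real.exp (-(((M + 1 : ℕ) : ℝ) / (1 - p)) * (s ^ 2 / 1 + t ^ 2 / 1)) =
      Real.exp (-(((M + 1 : ℕ) : ℝ) * s ^ 2)) *
        Real.exp (-((s * b) ^ 2 + (t * a) ^ 2) / 2) := by
    rw [← Real.exp_add]
    congr 1
    rw [hb, mul_pow, mul_pow, mul_pow, hsp2, ha2]
    field_simp
    ring
  have ha3 : ((M + 1 : ℕ) : ℝ) = a ^ 2 * (1 - p) / 2 := by
    rw [ha2]
    field_simp
  rw [density, if_pos ⟨hs, ht⟩, hI, hE, marcumKernel, nakagamiPDF, Nat.add_sub_cancel,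
    show ((M + 1 : ℕ) : ℤ) - 1 = (M : ℤ) by push_cast; ring, add_sub_cancel_right,
    show ((M : ℤ) + 1) = ((M + 1 : ℕ) : ℤ) by push_cast; rfl, zpow_natCast, zpow_natCast]
  rw [one_mul, one_mul, mul_one, mul_one, hb]
  generalize Real.exp (-(((M + 1 : ℕ) : ℝ) * s ^ 2)) = E₁
  generalize Real.exp (-((s * (a * √p)) ^ 2 + (t * a) ^ 2) / 2) = E₂
  generalize besselI _ _ = I
  have hx : (s * (a * √p)) ^ M = s ^ M * (a ^ M * √p ^ M) := by rw [mul_pow, mul_pow]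
  rw [hx, pow_succ ((M + 1 : ℕ) : ℝ) (M + 1)]
  -- Only the spare factor of `M + 1` is rewritten, to cancel `1 - p` in the denominator.
  nth_rw 2 [ha3]
  field_simp
  ring

lemma lintegral_Ioc_density (M : ℕ) {p a b s y : ℝ} (hp0 : 0 < p) (hp1 : p < 1)
    (ha : 0 < a) (ha2 : a ^ 2 = 2 * ((M + 1 : ℕ) : ℝ) / (1 - p)) (hb : b = a * √p)
    (hs : 0 < s) (hy : 0 < y) :
    ∫⁻ t in Set.Ioc 0 y, ENNReal.ofReal (density (M + 1) 1 1 p s t) =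
      ENNReal.ofReal (nakagamiPDF M ((M + 1 : ℕ) : ℝ) s * marcumQ (-M) (y * a) (s * b)) := by
  have hb0 : 0 < b := hb ▸ mul_pos ha (Real.sqrt_pos.2 hp0)
  have hc : Continuous fun t => nakagamiPDF M ((M + 1 : ℕ) : ℝ) s *
      (a * marcumKernel (M + 1) (s * b) (t * a)) := by
    have := continuous_marcumKernel_natCast_add_one M (mul_pos hs hb0)
    fun_prop
  rw [setLIntegral_congr_fun measurableSet_Ioc fun t ht => by
    rw [density_eq_mul_marcumKernel M hp0 hp1 ha ha2 hb hs ht.1],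
    ← ofReal_integral_eq_lintegral_ofReal
      ((hc.integrableOn_Icc (a := 0) (b := y)).mono_set Set.Ioc_subset_Icc_self)]
  · rw [integral_const_mul, integral_const_mul, ← intervalIntegral.integral_of_le hy.le,
      intervalIntegral.mul_integral_comp_mul_right, zero_mul,
      ← marcumP_eq_marcumQ M (mul_pos hs hb0) (mul_pos hy ha), marcumP]
  · filter_upwards [ae_restrict_mem measurableSet_Ioc] with t ht
    exact mul_nonneg (nakagamiPDF_nonneg _ (by positivity) hs.le)
      (mul_nonneg ha.le (marcumKernel_nonneg _ (mul_pos hs hb0) (mul_pos ht.1 ha)))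

/-! ### Negative binomial mixture -/

/-- The weights of the negative binomial law. -/
noncomputable def negBinomialWeight (M : ℕ) (p : ℝ) (k : ℕ) : ℝ :=
  (1 - p) ^ (M + 1) * ((k + M).choose M : ℝ) * p ^ k

lemma negBinomialWeight_nonneg (M : ℕ) {p : ℝ} (hp0 : 0 ≤ p) (hp1 : p ≤ 1) (k : ℕ) :
    0 ≤ negBinomialWeight M p k := by
  have : 0 ≤ 1 - p := by linarith
  rw [negBinomialWeight]
  positivity

lemma hasSum_negBinomialWeight (M : ℕ) {p : ℝ} (hp0 : 0 ≤ p) (hp1 : p < 1) :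
    HasSum (negBinomialWeight M p) 1 := by
  have h := (hasSum_choose_mul_geometric_of_norm_lt_one M
    (show ‖p‖ < 1 by rwa [Real.norm_of_nonneg hp0])).mul_left ((1 - p) ^ (M + 1))
  have hq : (1 - p) ≠ 0 := by linarith
  rw [mul_one_div_cancel (pow_ne_zero _ hq)] at h
  exact h.congr_fun fun k => by rw [negBinomialWeight, mul_assoc]

/-- Absorbing the factor into the binomial coefficient raises `M` by 1, so the moments of the
weights reduce to total masses. -/
lemma succ_mul_negBinomialWeight (M : ℕ) {p : ℝ} (hp1 : p < 1) (k : ℕ) :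
    ((k + M + 1 : ℕ) : ℝ) * negBinomialWeight M p k =
      (M + 1) / (1 - p) * negBinomialWeight (M + 1) p k := by
  have hq : (1 - p) ≠ 0 := by linarith
  have h : ((k + M + 1 : ℕ) : ℝ) * ((k + M).choose M : ℝ) =
      ((k + (M + 1)).choose (M + 1) : ℝ) * (M + 1) := by
    exact_mod_cast Nat.add_one_mul_choose_eq (k + M) M
  rw [negBinomialWeight, negBinomialWeight, pow_succ (1 - p) (M + 1)]
  rw [div_mul_eq_mul_div, eq_div_iff hq]
  linear_combination ((1 - p) ^ (M + 2) * p ^ k) * h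

lemma hasSum_negBinomialWeight_mean (M : ℕ) {p : ℝ} (hp0 : 0 ≤ p) (hp1 : p < 1) :
    HasSum (fun k => ((k + M + 1 : ℕ) : ℝ) * negBinomialWeight M p k) ((M + 1) / (1 - p)) := by
  simpa only [succ_mul_negBinomialWeight M hp1, mul_one] using
    (hasSum_negBinomialWeight (M + 1) hp0 hp1).mul_left ((M + 1) / (1 - p))

lemma hasSum_negBinomialWeight_rising (M : ℕ) {p : ℝ} (hp0 : 0 ≤ p) (hp1 : p < 1) :
    HasSum (fun k => ((k + M + 2 : ℕ) : ℝ) * (((k + M + 1 : ℕ) : ℝ) * negBinomialWeight M p k))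
      ((M + 1) * (M + 2) / (1 - p) ^ 2) := by
  have h := (hasSum_negBinomialWeight_mean (M + 1) hp0 hp1).mul_left ((M + 1) / (1 - p))
  have hq : (1 - p) ≠ 0 := by linarith
  have he : ((M : ℝ) + 1) / (1 - p) * ((((M + 1 : ℕ) : ℝ) + 1) / (1 - p)) =
      (M + 1) * (M + 2) / (1 - p) ^ 2 := by
    push_cast
    field_simp
    ring
  rw [← he]
  refine h.congr_fun fun k => ?_
  rw [succ_mul_negBinomialWeight M hp1, show k + (M + 1) + 1 = k + M + 2 by ring]
  ring

lemma hasSum_negBinomialWeight_sq (M : ℕ) {p : ℝ} (hp0 : 0 ≤ p) (hp1 : p < 1) :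
    HasSum (fun k => ((k + M + 1 : ℕ) : ℝ) * ((k + M + 1 : ℕ) : ℝ) * negBinomialWeight M p k)
      ((M + 1) * (M + 1 + p) / (1 - p) ^ 2) := by
  have h := (hasSum_negBinomialWeight_rising M hp0 hp1).sub
    (hasSum_negBinomialWeight_mean M hp0 hp1)
  have hq : (1 - p) ≠ 0 := by linarith
  have he : ((M : ℝ) + 1) * (M + 2) / (1 - p) ^ 2 - (M + 1) / (1 - p) =
      (M + 1) * (M + 1 + p) / (1 - p) ^ 2 := by
    field_simp
    ring
  rw [← he]
  refine h.congr_fun fun k => ?_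
  push_cast
  ring

/-- Each term of the Bessel series splits as a product in `s` and `t`: conditionally on a negative
binomial index the two variables are independent. -/
lemma hasSum_density (M : ℕ) {p s t : ℝ} (hp0 : 0 < p) (hp1 : p < 1)
    (hs : 0 < s) (ht : 0 < t) :
    HasSum (fun k => negBinomialWeight M p k *
      (nakagamiPDF (k + M) ((M + 1 : ℕ) / (1 - p)) s *
        nakagamiPDF (k + M) ((M + 1 : ℕ) / (1 - p)) t))
      (density (M + 1) 1 1 p s t) := by
  have hq : 0 < 1 - p := by linarith
  have hsp : 0 < √p := Real.sqrt_pos.2 hp0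
  have hsp2 : √p ^ 2 = p := Real.sq_sqrt hp0.le
  rw [density, if_pos ⟨hs, ht⟩, one_mul, one_mul, mul_one, mul_one, Real.sqrt_one, mul_one,
    div_one, div_one, besselI_eq, show ((M + 1 : ℕ) : ℤ) - 1 = (M : ℤ) by push_cast; ring,
    Int.natAbs_natCast, Nat.add_sub_cancel]
  refine (((hasSum_besselSeries M _).mul_left _).mul_left _).congr_fun fun k => ?_
  have hE : Real.exp (-(((M + 1 : ℕ) : ℝ) / (1 - p)) * (s ^ 2 + t ^ 2)) =
      Real.exp (-(((M + 1 : ℕ) : ℝ) / (1 - p) * s ^ 2)) *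
        Real.exp (-(((M + 1 : ℕ) : ℝ) / (1 - p) * t ^ 2)) := by
    rw [← Real.exp_add]
    congr 1
    ring
  have hz : (2 * ((M + 1 : ℕ) : ℝ) * √p * s * t / (1 - p)) ^ 2 / 4 =
      p * (((M + 1 : ℕ) : ℝ) * s * t / (1 - p)) ^ 2 := by
    linear_combination ((((M + 1 : ℕ) : ℝ) * s * t / (1 - p)) ^ 2) * hsp2
  rw [hE, hz, nakagamiPDF, nakagamiPDF, negBinomialWeight, Nat.cast_choose ℝ (Nat.le_add_left M k),
    Nat.add_sub_cancel, show 2 * ((M + 1 : ℕ) : ℝ) * √p * s * t / (1 - p) / 2 =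
      √p * (((M + 1 : ℕ) : ℝ) * s * t / (1 - p)) by ring, mul_pow, mul_pow]
  generalize Real.exp (-(((M + 1 : ℕ) : ℝ) / (1 - p) * s ^ 2)) = E₁
  generalize Real.exp (-(((M + 1 : ℕ) : ℝ) / (1 - p) * t ^ 2)) = E₂
  generalize ((M + 1 : ℕ) : ℝ) = c
  generalize 1 - p = q at hq
  simp only [div_pow, mul_pow]
  field_simp
  ring

lemma density_of_not_pos {m : ℕ} {w₁ w₂ p x y : ℝ} (h : ¬(0 < x ∧ 0 < y)) :
    density m w₁ w₂ p x y = 0 := if_neg h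

lemma measurable_density (m : ℕ) (w₁ w₂ p : ℝ) :
    Measurable fun z : ℝ × ℝ => density m w₁ w₂ p z.1 z.2 := by
  have hI (n : ℤ) : Continuous (besselI n) := by
    rw [funext (besselI_eq n)]
    have := continuous_besselSeries n.natAbs
    fun_prop
  have := hI ((m : ℤ) - 1)
  refine Measurable.ite ?_ (Continuous.measurable (by fun_prop)) measurable_const
  exact (measurableSet_lt measurable_const measurable_fst).inter
    (measurableSet_lt measurable_const measurable_snd)

/-- By the mixture and Tonelli, product test functions separate. Nonnegative integrals make
integrability unnecessary. -/
lemma lintegral_density_mul (M : ℕ) {p : ℝ} (hp0 : 0 < p) (hp1 : p < 1) {G H : ℝ → ENNReal}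
    (hG : Measurable G) (hH : Measurable H) :
    ∫⁻ z : ℝ × ℝ, ENNReal.ofReal (density (M + 1) 1 1 p z.1 z.2) * (G z.1 * H z.2) =
      ∑' k, ENNReal.ofReal (negBinomialWeight M p k) *
        ((∫⁻ x in Set.Ioi 0,
            ENNReal.ofReal (nakagamiPDF (k + M) ((M + 1 : ℕ) / (1 - p)) x) * G x) *
          ∫⁻ y in Set.Ioi 0,
            ENNReal.ofReal (nakagamiPDF (k + M) ((M + 1 : ℕ) / (1 - p)) y) * H y) := by
  have hA : 0 ≤ ((M + 1 : ℕ) : ℝ) / (1 - p) := div_nonneg (by positivity) (by linarith)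
  generalize hAdef : ((M + 1 : ℕ) : ℝ) / (1 - p) = A at hA
  have hm (k : ℕ) {G : ℝ → ENNReal} (hG : Measurable G) :
      Measurable fun x => ENNReal.ofReal (nakagamiPDF (k + M) A x) * G x :=
    (continuous_nakagamiPDF (k + M) A).measurable.ennreal_ofReal.mul hG
  have hsplit (z : ℝ × ℝ) : ENNReal.ofReal (density (M + 1) 1 1 p z.1 z.2) * (G z.1 * H z.2) =
      (Set.Ioi (0 : ℝ) ×ˢ Set.Ioi (0 : ℝ)).indicator (fun z =>
        ∑' k, ENNReal.ofReal (negBinomialWeight M p k) *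
          ((ENNReal.ofReal (nakagamiPDF (k + M) A z.1) * G z.1) *
            (ENNReal.ofReal (nakagamiPDF (k + M) A z.2) * H z.2))) z := by
    by_cases hz : 0 < z.1 ∧ 0 < z.2
    · rw [Set.indicator_of_mem (by exact hz)]
      have hw := negBinomialWeight_nonneg M hp0.le hp1.le
      have hn (k : ℕ) := mul_nonneg (nakagamiPDF_nonneg (k + M) hA hz.1.le)
        (nakagamiPDF_nonneg (k + M) hA hz.2.le)
      have hs := hasSum_density M hp0 hp1 hz.1 hz.2
      rw [hAdef] at hs
      rw [← hs.tsum_eq, ENNReal.ofReal_tsum_of_nonneg (fun k => mul_nonneg (hw k) (hn k))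
        hs.summable, ← ENNReal.tsum_mul_right]
      refine tsum_congr fun k => ?_
      rw [ENNReal.ofReal_mul (hw k), ENNReal.ofReal_mul (nakagamiPDF_nonneg (k + M) hA hz.1.le)]
      ring
    · rw [Set.indicator_of_notMem (by exact hz), density_of_not_pos hz]
      simp
  rw [lintegral_congr hsplit, lintegral_indicator (measurableSet_Ioi.prod measurableSet_Ioi),
    lintegral_tsum]
  · refine tsum_congr fun k => ?_
    rw [lintegral_const_mul, Measure.volume_eq_prod, ← Measure.prod_restrict,
      lintegral_prod_mul (hm k hG).aemeasurable (hm k hH).aemeasurable]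
    exact ((hm k hG).comp measurable_fst).mul ((hm k hH).comp measurable_snd)
  · intro k
    exact ((((hm k hG).comp measurable_fst).mul ((hm k hH).comp measurable_snd)).const_mul
      _).aemeasurable

/-! ### Moments of the normalised law -/

lemma lintegral_nakagamiPDF (N : ℕ) {A : ℝ} (hA : 0 < A) :
    ∫⁻ x in Set.Ioi 0, ENNReal.ofReal (nakagamiPDF N A x) = 1 := by
  have hN : (-1 : ℝ) < ((2 * N + 1 : ℕ) : ℝ) := by
    have : (0 : ℝ) ≤ ((2 * N + 1 : ℕ) : ℝ) := Nat.cast_nonneg _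
    linarith
  have hfun : nakagamiPDF N A = fun x => 2 * A ^ (N + 1) / (N.factorial : ℝ) *
      (x ^ (((2 * N + 1 : ℕ) : ℝ)) * Real.exp (-A * x ^ (2 : ℝ))) := by
    funext x
    rw [nakagamiPDF, Real.rpow_natCast, Real.rpow_two, neg_mul]
    ring
  have hint : IntegrableOn (nakagamiPDF N A) (Set.Ioi 0) := by
    rw [hfun]
    exact (integrableOn_rpow_mul_exp_neg_mul_rpow hN two_pos hA).const_mul _
  have hexp : (((2 * N + 1 : ℕ) : ℝ) + 1) / 2 = (N : ℝ) + 1 := by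
    push_cast
    ring
  rw [← ofReal_integral_eq_lintegral_ofReal hint, ← ENNReal.ofReal_one]
  · congr 1
    rw [hfun, integral_const_mul, integral_rpow_mul_exp_neg_mul_rpow two_pos hN hA, neg_div, hexp,
      Real.Gamma_nat_eq_factorial, Real.rpow_neg hA.le,
      show (N : ℝ) + 1 = ((N + 1 : ℕ) : ℝ) by push_cast; rfl, Real.rpow_natCast]
    field_simp
  · filter_upwards [ae_restrict_mem measurableSet_Ioi] with x hx
    exact nakagamiPDF_nonneg N hA.le (le_of_lt hx)

/-- Multiplying the density by `x ^ (2 * i)` raises its shape by `i`, up to a constant. -/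
lemma lintegral_nakagamiPDF_mul_pow (N i : ℕ) {A : ℝ} (hA : 0 < A) :
    ∫⁻ x in Set.Ioi 0, ENNReal.ofReal (nakagamiPDF N A x) * ENNReal.ofReal ((x ^ 2) ^ i) =
      ENNReal.ofReal ((N + i).factorial / (N.factorial * A ^ i)) := by
  have h (x : ℝ) : ENNReal.ofReal (nakagamiPDF N A x) * ENNReal.ofReal ((x ^ 2) ^ i) =
      ENNReal.ofReal ((N + i).factorial / (N.factorial * A ^ i)) *
        ENNReal.ofReal (nakagamiPDF (N + i) A x) := by
    rw [← ENNReal.ofReal_mul' (by positivity), ← ENNReal.ofReal_mul (by positivity)]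
    congr 1
    rw [nakagamiPDF, nakagamiPDF]
    field_simp
    ring
  simp only [h]
  rw [lintegral_const_mul _ (continuous_nakagamiPDF _ _).measurable.ennreal_ofReal,
    lintegral_nakagamiPDF _ hA, mul_one]

/-- The joint law of two normalised correlated Nakagami variables. -/
noncomputable def normalizedLaw (M : ℕ) (p : ℝ) : Measure (ℝ × ℝ) :=
  (volume : Measure (ℝ × ℝ)).withDensity fun z => ENNReal.ofReal (density (M + 1) 1 1 p z.1 z.2)

lemma lintegral_normalizedLaw_mul (M : ℕ) {p : ℝ} (hp0 : 0 < p) (hp1 : p < 1) {G H : ℝ → ENNReal}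
    (hG : Measurable G) (hH : Measurable H) :
    ∫⁻ z, G z.1 * H z.2 ∂normalizedLaw M p =
      ∑' k, ENNReal.ofReal (negBinomialWeight M p k) *
        ((∫⁻ x in Set.Ioi 0,
            ENNReal.ofReal (nakagamiPDF (k + M) ((M + 1 : ℕ) / (1 - p)) x) * G x) *
          ∫⁻ y in Set.Ioi 0,
            ENNReal.ofReal (nakagamiPDF (k + M) ((M + 1 : ℕ) / (1 - p)) y) * H y) := by
  rw [normalizedLaw, lintegral_withDensity_eq_lintegral_mul _
    (measurable_density _ _ _ _).ennreal_ofReal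
    (g := fun z => G z.1 * H z.2) ((hG.comp measurable_fst).mul (hH.comp measurable_snd))]
  exact lintegral_density_mul M hp0 hp1 hG hH

lemma lintegral_normalizedLaw_moment (M : ℕ) {p : ℝ} (hp0 : 0 < p) (hp1 : p < 1) (i j : ℕ) {v : ℝ}
    (hv : HasSum (fun k => negBinomialWeight M p k *
      ((k + M + i).factorial / ((k + M).factorial * ((M + 1 : ℕ) / (1 - p) : ℝ) ^ i) *
      ((k + M + j).factorial / ((k + M).factorial * ((M + 1 : ℕ) / (1 - p) : ℝ) ^ j)))) v) :
    ∫⁻ z, ENNReal.ofReal ((z.1 ^ 2) ^ i * (z.2 ^ 2) ^ j) ∂normalizedLaw M p =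
      ENNReal.ofReal v := by
  have hA : 0 < ((M + 1 : ℕ) / (1 - p) : ℝ) := div_pos (by positivity) (by linarith)
  have hm (i : ℕ) : Measurable fun x : ℝ => ENNReal.ofReal ((x ^ 2) ^ i) :=
    (by fun_prop : Measurable fun x : ℝ => (x ^ 2) ^ i).ennreal_ofReal
  have hw := negBinomialWeight_nonneg M hp0.le hp1.le
  have h := lintegral_normalizedLaw_mul M hp0 hp1 (hm i) (hm j)
  simp only [lintegral_nakagamiPDF_mul_pow _ _ hA] at h
  have hl (z : ℝ × ℝ) : ENNReal.ofReal ((z.1 ^ 2) ^ i * (z.2 ^ 2) ^ j) =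
      ENNReal.ofReal ((z.1 ^ 2) ^ i) * ENNReal.ofReal ((z.2 ^ 2) ^ j) :=
    ENNReal.ofReal_mul (by positivity)
  simp only [hl]
  rw [h, ← hv.tsum_eq, ENNReal.ofReal_tsum_of_nonneg (fun k => ?_) hv.summable]
  · refine tsum_congr fun k => ?_
    rw [ENNReal.ofReal_mul (hw k), ENNReal.ofReal_mul (by positivity)]
  · have := hw k
    positivity

lemma factorial_add_one_div (N : ℕ) (A : ℝ) :
    ((N + 1).factorial : ℝ) / (N.factorial * A ^ 1) = (N + 1 : ℕ) / A := by
  rw [Nat.factorial_succ, pow_one]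
  push_cast
  field_simp

lemma factorial_add_two_div (N : ℕ) (A : ℝ) :
    ((N + 2).factorial : ℝ) / (N.factorial * A ^ 2) = (N + 2 : ℕ) * (N + 1 : ℕ) / A ^ 2 := by
  rw [Nat.factorial_succ (N + 1), Nat.factorial_succ]
  push_cast
  field_simp
  ring

lemma factorial_add_zero_div (N : ℕ) (A : ℝ) :
    ((N + 0).factorial : ℝ) / (N.factorial * A ^ 0) = 1 := by
  rw [add_zero, pow_zero, mul_one, div_self (by positivity)]

lemma hasSum_mean (M : ℕ) {p : ℝ} (hp0 : 0 < p) (hp1 : p < 1) :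
    HasSum (fun k => negBinomialWeight M p k *
      ((k + M + 1 : ℕ) / ((M + 1 : ℕ) / (1 - p) : ℝ))) 1 := by
  have hq : (1 - p) ≠ 0 := by linarith
  have h := (hasSum_negBinomialWeight_mean M hp0.le hp1).div_const ((M + 1 : ℕ) / (1 - p) : ℝ)
  push_cast at h ⊢
  rw [div_self (div_ne_zero (by positivity) hq)] at h
  exact h.congr_fun fun k => by ring

lemma lintegral_normalizedLaw_fst_sq (M : ℕ) {p : ℝ} (hp0 : 0 < p) (hp1 : p < 1) :
    ∫⁻ z, ENNReal.ofReal (z.1 ^ 2) ∂normalizedLaw M p = 1 := by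
  have h := lintegral_normalizedLaw_moment M hp0 hp1 1 0 (v := 1) (by
    simpa only [factorial_add_one_div, factorial_add_zero_div, mul_one] using
      hasSum_mean M hp0 hp1)
  simpa using h

lemma lintegral_normalizedLaw_snd_sq (M : ℕ) {p : ℝ} (hp0 : 0 < p) (hp1 : p < 1) :
    ∫⁻ z, ENNReal.ofReal (z.2 ^ 2) ∂normalizedLaw M p = 1 := by
  have h := lintegral_normalizedLaw_moment M hp0 hp1 0 1 (v := 1) (by
    simpa only [factorial_add_one_div, factorial_add_zero_div, one_mul] using
      hasSum_mean M hp0 hp1)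
  simpa using h

lemma hasSum_second_moment (M : ℕ) {p : ℝ} (hp0 : 0 < p) (hp1 : p < 1) :
    HasSum (fun k => negBinomialWeight M p k *
      ((k + M + 2 : ℕ) * (k + M + 1 : ℕ) / ((M + 1 : ℕ) / (1 - p) : ℝ) ^ 2))
      ((M + 2) / (M + 1)) := by
  have hq : (1 - p) ≠ 0 := by linarith
  have h := (hasSum_negBinomialWeight_rising M hp0.le hp1).div_const
    (((M + 1 : ℕ) / (1 - p) : ℝ) ^ 2)
  have he : ((M : ℝ) + 1) * (M + 2) / (1 - p) ^ 2 / ((M + 1 : ℕ) / (1 - p) : ℝ) ^ 2 =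
      (M + 2) / (M + 1) := by
    push_cast
    field_simp
  rw [he] at h
  exact h.congr_fun fun k => by ring

lemma lintegral_normalizedLaw_fst_fourth (M : ℕ) {p : ℝ} (hp0 : 0 < p) (hp1 : p < 1) :
    ∫⁻ z, ENNReal.ofReal ((z.1 ^ 2) ^ 2) ∂normalizedLaw M p =
      ENNReal.ofReal ((M + 2) / (M + 1)) := by
  have h := lintegral_normalizedLaw_moment M hp0 hp1 2 0 (v := (M + 2) / (M + 1)) (by
    simpa only [factorial_add_two_div, factorial_add_zero_div, mul_one] using
      hasSum_second_moment M hp0 hp1)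
  simpa using h

lemma lintegral_normalizedLaw_snd_fourth (M : ℕ) {p : ℝ} (hp0 : 0 < p) (hp1 : p < 1) :
    ∫⁻ z, ENNReal.ofReal ((z.2 ^ 2) ^ 2) ∂normalizedLaw M p =
      ENNReal.ofReal ((M + 2) / (M + 1)) := by
  have h := lintegral_normalizedLaw_moment M hp0 hp1 0 2 (v := (M + 2) / (M + 1)) (by
    simpa only [factorial_add_two_div, factorial_add_zero_div, one_mul] using
      hasSum_second_moment M hp0 hp1)
  simpa using h

lemma lintegral_normalizedLaw_sq_mul_sq (M : ℕ) {p : ℝ} (hp0 : 0 < p) (hp1 : p < 1) :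
    ∫⁻ z, ENNReal.ofReal (z.1 ^ 2 * z.2 ^ 2) ∂normalizedLaw M p =
      ENNReal.ofReal ((M + 1 + p) / (M + 1)) := by
  have hq : (1 - p) ≠ 0 := by linarith
  have h := lintegral_normalizedLaw_moment M hp0 hp1 1 1 (v := (M + 1 + p) / (M + 1)) (by
    simp only [factorial_add_one_div]
    have h := (hasSum_negBinomialWeight_sq M hp0.le hp1).div_const
      (((M + 1 : ℕ) / (1 - p) : ℝ) ^ 2)
    have he : ((M : ℝ) + 1) * (M + 1 + p) / (1 - p) ^ 2 / ((M + 1 : ℕ) / (1 - p) : ℝ) ^ 2 =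
        (M + 1 + p) / (M + 1) := by
      push_cast
      field_simp
    rw [he] at h
    exact h.congr_fun fun k => by ring)
  simpa using h

/-! ### Reduction to unit scales -/

lemma density_eq_scaled (M : ℕ) {w₁ w₂ p : ℝ} (hw₁ : 0 < w₁) (hw₂ : 0 < w₂) (hp0 : 0 < p)
    (hp1 : p < 1) (x y : ℝ) :
    density (M + 1) w₁ w₂ p x y = (√w₁)⁻¹ * (√w₂)⁻¹ *
      density (M + 1) 1 1 p (x * (√w₁)⁻¹) (y * (√w₂)⁻¹) := by
  have h₁ := Real.sqrt_pos.2 hw₁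
  have h₂ := Real.sqrt_pos.2 hw₂
  have hsp := Real.sqrt_pos.2 hp0
  have e₁ := Real.sq_sqrt hw₁.le
  have e₂ := Real.sq_sqrt hw₂.le
  have hq : 0 < 1 - p := by linarith
  have hiff : (0 < x * (√w₁)⁻¹ ∧ 0 < y * (√w₂)⁻¹) ↔ 0 < x ∧ 0 < y := by
    rw [mul_pos_iff_of_pos_right (inv_pos.2 h₁), mul_pos_iff_of_pos_right (inv_pos.2 h₂)]
  rw [density, density]
  by_cases h : 0 < x ∧ 0 < y
  · rw [if_pos h, if_pos (hiff.2 h), Real.sqrt_mul (by positivity), Real.sqrt_mul hw₁.le]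
    have hx : x ^ 2 / w₁ = (x * (√w₁)⁻¹) ^ 2 / 1 := by
      rw [mul_pow, inv_pow, e₁]
      ring
    have hy : y ^ 2 / w₂ = (y * (√w₂)⁻¹) ^ 2 / 1 := by
      rw [mul_pow, inv_pow, e₂]
      ring
    have hI : 2 * ((M + 1 : ℕ) : ℝ) * √p * x * y / ((1 - p) * (√w₁ * √w₂)) =
        2 * ((M + 1 : ℕ) : ℝ) * √p * (x * (√w₁)⁻¹) * (y * (√w₂)⁻¹) / ((1 - p) * √(1 * 1)) := by
      rw [one_mul, Real.sqrt_one]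
      field_simp
    rw [hx, hy, hI, one_mul, one_mul, mul_one, mul_one]
    nth_rw 1 [← e₁, ← e₂]
    generalize √w₁ = u at *
    generalize √w₂ = v at *
    rw [Nat.add_sub_cancel]
    simp only [mul_pow, inv_pow]
    field_simp
    ring
  · rw [if_neg h, if_neg (mt hiff.1 h), mul_zero]

lemma map_prodMap_mul_volume {c₁ c₂ : ℝ} (h₁ : 0 < c₁) (h₂ : 0 < c₂) :
    (volume : Measure (ℝ × ℝ)).map (Prod.map (· * c₁) (· * c₂)) =
      ENNReal.ofReal (c₁⁻¹ * c₂⁻¹) • volume := by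
  rw [Measure.volume_eq_prod, ← Measure.map_prod_map _ _ (measurable_mul_const c₁)
    (measurable_mul_const c₂), Real.map_volume_mul_right h₁.ne', Real.map_volume_mul_right h₂.ne',
    Measure.prod_smul_left, Measure.prod_smul_right, smul_smul, abs_of_pos (inv_pos.2 h₁),
    abs_of_pos (inv_pos.2 h₂), ENNReal.ofReal_mul (inv_pos.2 h₁).le]

lemma map_withDensity_density (M : ℕ) {w₁ w₂ p : ℝ} (hw₁ : 0 < w₁) (hw₂ : 0 < w₂) (hp0 : 0 < p)
    (hp1 : p < 1) :
    ((volume : Measure (ℝ × ℝ)).withDensity fun z =>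
      ENNReal.ofReal (density (M + 1) w₁ w₂ p z.1 z.2)).map
        (Prod.map (· * (√w₁)⁻¹) (· * (√w₂)⁻¹)) = normalizedLaw M p := by
  have h₁ := inv_pos.2 (Real.sqrt_pos.2 hw₁)
  have h₂ := inv_pos.2 (Real.sqrt_pos.2 hw₂)
  have hT : Measurable (Prod.map (· * (√w₁)⁻¹) (· * (√w₂)⁻¹) : ℝ × ℝ → ℝ × ℝ) :=
    (measurable_mul_const _).prodMap (measurable_mul_const _)
  have hd := (measurable_density (M + 1) 1 1 p).ennreal_ofReal
  ext s hs
  rw [Measure.map_apply hT hs, withDensity_apply _ (hT hs), normalizedLaw,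
    withDensity_apply _ hs]
  have hf (z : ℝ × ℝ) : ENNReal.ofReal (density (M + 1) w₁ w₂ p z.1 z.2) =
      ENNReal.ofReal ((√w₁)⁻¹ * (√w₂)⁻¹) * (fun z : ℝ × ℝ =>
        ENNReal.ofReal (density (M + 1) 1 1 p z.1 z.2))
          (Prod.map (· * (√w₁)⁻¹) (· * (√w₂)⁻¹) z) := by
    rw [density_eq_scaled M hw₁ hw₂ hp0 hp1, ENNReal.ofReal_mul (by positivity)]
    rfl
  rw [lintegral_congr hf]
  refine (lintegral_const_mul _ (hd.comp hT)).trans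
    ((congrArg _ (setLIntegral_map hs hd hT).symm).trans ?_)
  rw [map_prodMap_mul_volume h₁ h₂, Measure.restrict_smul, lintegral_smul_measure, smul_eq_mul,
    ← mul_assoc, ← ENNReal.ofReal_mul (by positivity)]
  rw [show (√w₁)⁻¹ * (√w₂)⁻¹ * ((√w₁)⁻¹⁻¹ * (√w₂)⁻¹⁻¹) = 1 by field_simp, ENNReal.ofReal_one,
    one_mul]

/-! ### Marginal and tail probabilities -/

/-- The sum over `k` is an exponential series whose value `exp (p * A * t ^ 2)` lowers the rate from
`A` to `(1 - p) * A`. -/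
lemma hasSum_negBinomialWeight_mul_nakagamiPDF (M : ℕ) {p : ℝ} (A t : ℝ) :
    HasSum (fun k => negBinomialWeight M p k * nakagamiPDF (k + M) A t)
      (nakagamiPDF M ((1 - p) * A) t) := by
  have h := (NormedSpace.expSeries_div_hasSum_exp (p * A * t ^ 2)).mul_left
    (2 * ((1 - p) * A) ^ (M + 1) / (M.factorial : ℝ) * t ^ (2 * M + 1) * Real.exp (-(A * t ^ 2)))
  rw [← Real.exp_eq_exp_ℝ] at h
  have he : 2 * ((1 - p) * A) ^ (M + 1) / (M.factorial : ℝ) * t ^ (2 * M + 1) *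
      Real.exp (-(A * t ^ 2)) * Real.exp (p * A * t ^ 2) = nakagamiPDF M ((1 - p) * A) t := by
    rw [nakagamiPDF, mul_assoc _ (Real.exp _), ← Real.exp_add]
    congr 2
    ring
  rw [he] at h
  refine h.congr_fun fun k => ?_
  rw [negBinomialWeight, nakagamiPDF, Nat.cast_choose ℝ (Nat.le_add_left M k),
    Nat.add_sub_cancel]
  simp only [mul_pow]
  field_simp
  ring

lemma lowerGamma_div_factorial (M : ℕ) (c y : ℝ) :
    lowerGamma ((M + 1 : ℕ) : ℝ) (c * y ^ 2) / (M.factorial : ℝ) =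
      ∫ t in (0 : ℝ)..y, nakagamiPDF M c t := by
  have h1 (t : ℝ) : HasDerivAt (fun t : ℝ => c * t ^ 2) (2 * c * t) t :=
    ((hasDerivAt_pow 2 t).const_mul c).congr_deriv (by simp; ring)
  have h := intervalIntegral.integral_comp_mul_deriv (a := 0) (b := y)
    (g := fun u : ℝ => u ^ M * Real.exp (-u)) (fun t _ => h1 t) (by fun_prop) (by fun_prop)
  have hl : lowerGamma ((M + 1 : ℕ) : ℝ) (c * y ^ 2) =
      ∫ u in (0 : ℝ)..(c * y ^ 2), u ^ M * Real.exp (-u) := by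
    rw [lowerGamma]
    congr 1
    funext u
    rw [show ((M + 1 : ℕ) : ℝ) - 1 = (M : ℝ) by push_cast; ring, Real.rpow_natCast]
  rw [zero_pow two_ne_zero, mul_zero] at h
  rw [hl, ← h, ← intervalIntegral.integral_div]
  congr 1
  funext t
  simp only [nakagamiPDF, Function.comp]
  ring

lemma lintegral_Ioi_mul_indicator_Iic {f : ℝ → ENNReal} (y : ℝ) :
    ∫⁻ t in Set.Ioi 0, f t * (Set.Iic y).indicator 1 t = ∫⁻ t in Set.Ioc 0 y, f t := by
  rw [← Set.Ioi_inter_Iic, Set.inter_comm, ← Measure.restrict_restrict measurableSet_Iic,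
    ← lintegral_indicator measurableSet_Iic]
  refine lintegral_congr fun t => ?_
  by_cases ht : t ∈ Set.Iic y <;> simp [ht]

lemma normalizedLaw_snd_le (M : ℕ) {p y : ℝ} (hp0 : 0 < p) (hp1 : p < 1) (hy : 0 < y) :
    normalizedLaw M p {z | z.2 ≤ y} = ENNReal.ofReal
      (lowerGamma ((M + 1 : ℕ) : ℝ) ((M + 1 : ℕ) * y ^ 2) / (M.factorial : ℝ)) := by
  have hq : 0 < 1 - p := by linarith
  have hA : 0 < ((M + 1 : ℕ) / (1 - p) : ℝ) := div_pos (by positivity) hq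
  have hset : MeasurableSet {z : ℝ × ℝ | z.2 ≤ y} :=
    measurableSet_le measurable_snd measurable_const
  have h := lintegral_normalizedLaw_mul M hp0 hp1 (G := fun _ => 1) measurable_const
    (H := (Set.Iic y).indicator 1) (measurable_one.indicator measurableSet_Iic)
  simp only [one_mul, mul_one, lintegral_nakagamiPDF _ hA, lintegral_Ioi_mul_indicator_Iic] at h
  have hl : ∫⁻ z, (Set.Iic y).indicator 1 z.2 ∂normalizedLaw M p =
      normalizedLaw M p {z | z.2 ≤ y} := by
    rw [← lintegral_indicator_one hset]
    rfl
  have hc (k : ℕ) := (continuous_nakagamiPDF (k + M) ((M + 1 : ℕ) / (1 - p) : ℝ)).measurable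
  have hw := negBinomialWeight_nonneg M hp0.le hp1.le
  rw [← hl, h, lowerGamma_div_factorial, intervalIntegral.integral_of_le hy.le,
    ofReal_integral_eq_lintegral_ofReal]
  · simp only [← lintegral_const_mul _ (hc _).ennreal_ofReal]
    rw [← lintegral_tsum fun k => ((hc k).ennreal_ofReal.const_mul _).aemeasurable]
    refine setLIntegral_congr_fun measurableSet_Ioc fun t ht => ?_
    have hs := hasSum_negBinomialWeight_mul_nakagamiPDF M (p := p) ((M + 1 : ℕ) / (1 - p) : ℝ) t
    rw [mul_div_cancel₀ _ hq.ne'] at hs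
    rw [← hs.tsum_eq, ENNReal.ofReal_tsum_of_nonneg (fun k => mul_nonneg (hw k)
      (nakagamiPDF_nonneg _ hA.le ht.1.le)) hs.summable]
    exact tsum_congr fun k => (ENNReal.ofReal_mul (hw k)).symm
  · exact (continuous_nakagamiPDF M _).integrableOn_Icc.mono_set Set.Ioc_subset_Icc_self
  · filter_upwards [ae_restrict_mem measurableSet_Ioc] with t ht
    exact nakagamiPDF_nonneg _ (by positivity) ht.1.le

lemma normalizedLaw_lt_fst_and_snd_le (M : ℕ) {p a b r y : ℝ} (hp0 : 0 < p) (hp1 : p < 1)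
    (ha : 0 < a) (ha2 : a ^ 2 = 2 * ((M + 1 : ℕ) : ℝ) / (1 - p)) (hb : b = a * √p)
    (hr : 0 < r) (hy : 0 < y) :
    0 ≤ marcumTail M a b ((M + 1 : ℕ) : ℝ) y r ∧
    normalizedLaw M p {z | r < z.1 ∧ z.2 ≤ y} =
      ENNReal.ofReal (marcumTail M a b ((M + 1 : ℕ) : ℝ) y r) := by
  have hb0 : 0 < b := hb ▸ mul_pos ha (Real.sqrt_pos.2 hp0)
  have hab : a ^ 2 = b ^ 2 + 2 * ((M + 1 : ℕ) : ℝ) := by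
    have hq : (1 - p) ≠ 0 := by linarith
    rw [eq_div_iff hq] at ha2
    rw [hb, mul_pow, Real.sq_sqrt hp0.le]
    linear_combination ha2
  have key := lintegral_Ioi_nakagamiPDF_mul_marcumQ M hab ha hb0
    (Nat.cast_nonneg (α := ℝ) (M + 1)) hy hr
  refine ⟨key.1, ?_⟩
  have hset : {z : ℝ × ℝ | r < z.1 ∧ z.2 ≤ y} = Set.Ioi r ×ˢ Set.Iic y := rfl
  have hd := (measurable_density (M + 1) 1 1 p).ennreal_ofReal
  rw [← key.2, hset, normalizedLaw,
    withDensity_apply _ (measurableSet_Ioi.prod measurableSet_Iic), Measure.volume_eq_prod,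
    ← Measure.prod_restrict, lintegral_prod _ hd.aemeasurable]
  refine setLIntegral_congr_fun measurableSet_Ioi fun s hs => ?_
  have hs0 : 0 < s := hr.trans hs
  rw [← lintegral_Ioc_density M hp0 hp1 ha ha2 hb hs0 hy, ← Set.Ioi_inter_Iic,
    ← Measure.restrict_restrict measurableSet_Ioi, ← lintegral_indicator measurableSet_Ioi]
  refine lintegral_congr fun t => ?_
  by_cases ht : t ∈ Set.Ioi (0 : ℝ)
  · rw [Set.indicator_of_mem ht]
  · rw [Set.indicator_of_notMem ht, density_of_not_pos fun h => ht h.2, ENNReal.ofReal_zero]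

/-! ### From the normalised law to random variables -/

section Law

variable {S : Type*} [MeasurableSpace S] {P : Measure S} {X Y : S → ℝ} {M : ℕ} {p : ℝ}

lemma jointCDF_of_hasLaw_normalizedLaw [IsProbabilityMeasure P]
    (h : HasLaw (fun s => (X s, Y s)) (normalizedLaw M p) P) (hp0 : 0 < p)
    (hp1 : p < 1) {a b r y : ℝ} (ha : 0 < a)
    (ha2 : a ^ 2 = 2 * ((M + 1 : ℕ) : ℝ) / (1 - p)) (hb : b = a * √p) (hr : 0 < r) (hy : 0 < y) :
    jointCDF X Y P r y =
      lowerGamma ((M + 1 : ℕ) : ℝ) ((M + 1 : ℕ) * y ^ 2) / (M.factorial : ℝ) -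
        marcumTail M a b ((M + 1 : ℕ) : ℝ) y r := by
  -- The total mass is inherited from `P` through the law, not computed from the density.
  have : IsProbabilityMeasure (normalizedLaw M p) := h.isProbabilityMeasure_iff.1 inferInstance
  have hfst : MeasurableSet {z : ℝ × ℝ | z.1 ≤ r} :=
    measurableSet_le measurable_fst measurable_const
  have hsnd : MeasurableSet {z : ℝ × ℝ | z.2 ≤ y} :=
    measurableSet_le measurable_snd measurable_const
  have htail := normalizedLaw_lt_fst_and_snd_le M hp0 hp1 ha ha2 hb hr hy
  have hmarg := normalizedLaw_snd_le M hp0 hp1 hy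
  have hγ : 0 ≤ lowerGamma ((M + 1 : ℕ) : ℝ) ((M + 1 : ℕ) * y ^ 2) / (M.factorial : ℝ) := by
    rw [lowerGamma_div_factorial]
    exact intervalIntegral.integral_nonneg hy.le
      fun t ht => nakagamiPDF_nonneg _ (by positivity) ht.1
  have hcdf : jointCDF X Y P r y = (normalizedLaw M p).real {z | z.1 ≤ r ∧ z.2 ≤ y} :=
    h.measureReal_eq (p := fun z => z.1 ≤ r ∧ z.2 ≤ y) (hfst.inter hsnd)
  have hadd := measureReal_sdiff_add_inter (μ := normalizedLaw M p) (s := {z | z.2 ≤ y}) hfst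
  have e1 : {z : ℝ × ℝ | z.2 ≤ y} \ {z | z.1 ≤ r} = {z | r < z.1 ∧ z.2 ≤ y} := by
    ext z
    simp [and_comm]
  have e2 : {z : ℝ × ℝ | z.2 ≤ y} ∩ {z | z.1 ≤ r} = {z | z.1 ≤ r ∧ z.2 ≤ y} := by
    ext z
    simp [and_comm]
  rw [e1, e2, measureReal_def, measureReal_def _ {z : ℝ × ℝ | z.2 ≤ y}, htail.2, hmarg,
    ENNReal.toReal_ofReal htail.1, ENNReal.toReal_ofReal hγ] at hadd
  rw [hcdf]
  linarith

lemma integral_eq_of_lintegral_comp {μ : Measure (ℝ × ℝ)}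
    (h : HasLaw (fun s => (X s, Y s)) μ P) {φ : ℝ × ℝ → ℝ} (hφ : Measurable φ)
    (hφ0 : ∀ z, 0 ≤ φ z) {v : ℝ} (hv0 : 0 ≤ v)
    (hv : ∫⁻ z, ENNReal.ofReal (φ z) ∂μ = ENNReal.ofReal v) :
    Integrable (fun s => φ (X s, Y s)) P ∧ ∫ s, φ (X s, Y s) ∂P = v := by
  have hm : AEStronglyMeasurable (fun s => φ (X s, Y s)) P :=
    (hφ.comp_aemeasurable h.aemeasurable).aestronglyMeasurable
  have hl := h.lintegral_comp hφ.ennreal_ofReal.aemeasurable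
  rw [hv] at hl
  constructor
  · refine ⟨hm, ?_⟩
    rw [hasFiniteIntegral_iff_ofReal (.of_forall fun s => hφ0 _), hl]
    exact ENNReal.ofReal_lt_top
  · rw [integral_eq_lintegral_of_nonneg_ae (.of_forall fun s => hφ0 _) hm, hl,
      ENNReal.toReal_ofReal hv0]

lemma integral_sq_of_hasLaw_normalizedLaw
    (h : HasLaw (fun s => (X s, Y s)) (normalizedLaw M p) P) (hp0 : 0 < p) (hp1 : p < 1) :
    ∫ s, X s ^ 2 ∂P = 1 ∧ ∫ s, Y s ^ 2 ∂P = 1 := by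
  have h1 := lintegral_normalizedLaw_fst_sq M hp0 hp1
  have h2 := lintegral_normalizedLaw_snd_sq M hp0 hp1
  rw [← ENNReal.ofReal_one] at h1 h2
  exact ⟨(integral_eq_of_lintegral_comp h (φ := fun z => z.1 ^ 2) (by fun_prop)
    (fun _ => sq_nonneg _) zero_le_one h1).2,
    (integral_eq_of_lintegral_comp h (φ := fun z => z.2 ^ 2) (by fun_prop)
    (fun _ => sq_nonneg _) zero_le_one h2).2⟩

/-- With unit means, the covariance of the squares is `p / (M + 1)` and both variances are `1 / (M +
1)`. -/
lemma powerCorrelation_of_hasLaw_normalizedLaw [IsProbabilityMeasure P]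
    (h : HasLaw (fun s => (X s, Y s)) (normalizedLaw M p) P) (hp0 : 0 < p) (hp1 : p < 1) :
    powerCorrelation X Y P = p := by
  have hmean := integral_sq_of_hasLaw_normalizedLaw h hp0 hp1
  have hX := h.aemeasurable.fst
  have hY := h.aemeasurable.snd
  have h1 := integral_eq_of_lintegral_comp h (φ := fun z => (z.1 ^ 2) ^ 2) (by fun_prop)
    (fun _ => sq_nonneg _) (by positivity) (lintegral_normalizedLaw_fst_fourth M hp0 hp1)
  have h2 := integral_eq_of_lintegral_comp h (φ := fun z => (z.2 ^ 2) ^ 2) (by fun_prop)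
    (fun _ => sq_nonneg _) (by positivity) (lintegral_normalizedLaw_snd_fourth M hp0 hp1)
  have h3 := integral_eq_of_lintegral_comp h (φ := fun z => z.1 ^ 2 * z.2 ^ 2) (by fun_prop)
    (fun _ => by positivity) (by positivity) (lintegral_normalizedLaw_sq_mul_sq M hp0 hp1)
  have hLX : MemLp (fun s => X s ^ 2) 2 P :=
    (memLp_two_iff_integrable_sq (hX.pow_const 2).aestronglyMeasurable).2 h1.1
  have hLY : MemLp (fun s => Y s ^ 2) 2 P :=
    (memLp_two_iff_integrable_sq (hY.pow_const 2).aestronglyMeasurable).2 h2.1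
  have e1 : P[(fun s => X s ^ 2) ^ 2] = ((M : ℝ) + 2) / (M + 1) := h1.2
  have e2 : P[(fun s => Y s ^ 2) ^ 2] = ((M : ℝ) + 2) / (M + 1) := h2.2
  have e3 : P[(fun s => X s ^ 2) * (fun s => Y s ^ 2)] = ((M : ℝ) + 1 + p) / (M + 1) := h3.2
  rw [powerCorrelation, covariance_eq_sub hLX hLY, variance_eq_sub hLX, variance_eq_sub hLY, e1, e2,
    e3, hmean.1, hmean.2]
  have hM : (0 : ℝ) < (M : ℝ) + 1 := by positivity
  have ev : ((M : ℝ) + 2) / (M + 1) - 1 ^ 2 = 1 / (M + 1) := by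
    field_simp
    ring
  rw [ev, Real.sqrt_mul_self (by positivity)]
  field_simp
  ring

end Law

lemma IsCorrelatedNakagami.exists_hasLaw_normalizedLaw {S : Type*} [MeasurableSpace S]
    {P : Measure S} {M : ℕ} {R₁ R₂ : S → ℝ} (hR : IsCorrelatedNakagami (M + 1) R₁ R₂ P) :
    ∃ w₁ w₂ p : ℝ, 0 < w₁ ∧ 0 < w₂ ∧ 0 < p ∧ p < 1 ∧
      HasLaw (fun s => (R₁ s / √w₁, R₂ s / √w₂)) (normalizedLaw M p) P := by
  obtain ⟨w₁, w₂, p, hw₁, hw₂, hp0, hp1, h⟩ := hR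
  refine ⟨w₁, w₂, p, hw₁, hw₂, hp0, hp1, ?_⟩
  have hT : HasLaw (Prod.map (· * (√w₁)⁻¹) (· * (√w₂)⁻¹) : ℝ × ℝ → ℝ × ℝ) (normalizedLaw M p)
      ((volume : Measure (ℝ × ℝ)).withDensity fun z =>
        ENNReal.ofReal (density (M + 1) w₁ w₂ p z.1 z.2)) :=
    ⟨((measurable_mul_const _).prodMap (measurable_mul_const _)).aemeasurable,
      map_withDensity_density M hw₁ hw₂ hp0 hp1⟩
  exact hT.comp h

lemma powerCorrelation_div_const {S : Type*} [MeasurableSpace S] (P : Measure S) (X Y : S → ℝ)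
    {c d : ℝ} (hc : 0 < c) (hd : 0 < d) :
    powerCorrelation (fun s => X s / c) (fun s => Y s / d) P = powerCorrelation X Y P := by
  have e (Z : S → ℝ) (c : ℝ) : (fun s => (Z s / c) ^ 2) = fun s => (c ^ 2)⁻¹ * Z s ^ 2 := by
    funext s
    rw [div_pow, div_eq_inv_mul]
  rw [powerCorrelation, powerCorrelation, e X, e Y, covariance_const_mul_left,
    covariance_const_mul_right, variance_const_mul, variance_const_mul,
    show ∀ u v : ℝ, ((c ^ 2)⁻¹) ^ 2 * u * (((d ^ 2)⁻¹) ^ 2 * v) =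
      ((c ^ 2)⁻¹ * (d ^ 2)⁻¹) ^ 2 * (u * v) from fun u v => by ring,
    Real.sqrt_mul (sq_nonneg _), Real.sqrt_sq (by positivity), ← mul_assoc,
    mul_div_mul_left _ _ (by positivity)]

end BivariateNakagami

/-! ### The theorem -/

open BivariateNakagami
theorem corollary1 {S : Type*} [MeasurableSpace S] (P : Measure S) [IsProbabilityMeasure P]
    (m : ℕ) (hm : 0 < m) (R₁ R₂ : S → ℝ) (hR : IsCorrelatedNakagami m R₁ R₂ P)
    (Ω₁ Ω₂ ρ a b : ℝ)
    (hΩ₁ : Ω₁ = ∫ s, R₁ s ^ 2 ∂P) (hΩ₂ : Ω₂ = ∫ s, R₂ s ^ 2 ∂P)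
    (hρ : ρ = powerCorrelation R₁ R₂ P)
    (ha : a = √(2 * m / (1 - ρ))) (hb : b = a * √ρ) :
    (∀ r₁ r₂ : ℝ, 0 < r₁ → 0 < r₂ →
      jointCDF (fun s => R₁ s / √Ω₁) (fun s => R₂ s / √Ω₂) P r₁ r₂ =
        lowerGamma m (m * r₂ ^ 2) / ((m - 1).factorial : ℝ)
        - Real.exp (-(m * r₁ ^ 2)) *
            ∑ k ∈ Finset.range m,
              (m * r₁ ^ 2) ^ k / (k.factorial : ℝ) * marcumQ (1 - (k : ℤ)) (r₂ * a) (r₁ * b)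
        + Real.exp (-(m * r₂ ^ 2)) *
            ∑ k ∈ Finset.range m, ∑ i ∈ Finset.Icc 1 (m - k), ∑ r ∈ Finset.range (2 * (i - 1) + 1),
              (1 - ρ) ^ r / ((k.factorial : ℝ) * ρ ^ r) *
                (m * r₁ ^ 2 / ρ) ^ ((k : ℤ) + (i : ℤ) - (r : ℤ) - 1) *
                coeffA r i ((k : ℝ) + (i : ℝ)) ((r₁ * r₂ * a * b) ^ 2 / 4) *
                marcumQ (2 - (k : ℤ) - (i : ℤ) + (r : ℤ)) (r₂ * b) (r₁ * a)) ∧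
    (∀ r₁ r₂ : ℝ,
      jointCDF R₁ R₂ P r₁ r₂ =
        jointCDF (fun s => R₁ s / √Ω₁) (fun s => R₂ s / √Ω₂) P (r₁ / √Ω₁) (r₂ / √Ω₂)) := by
  obtain ⟨M, rfl⟩ : ∃ M, m = M + 1 := ⟨m - 1, by omega⟩
  obtain ⟨w₁, w₂, p, hw₁, hw₂, hp0, hp1, hlaw⟩ := hR.exists_hasLaw_normalizedLaw
  have hs₁ := Real.sqrt_pos.2 hw₁
  have hs₂ := Real.sqrt_pos.2 hw₂
  have hmean := integral_sq_of_hasLaw_normalizedLaw hlaw hp0 hp1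
  simp only [div_pow, Real.sq_sqrt hw₁.le, Real.sq_sqrt hw₂.le, integral_div,
    div_eq_one_iff_eq hw₁.ne', div_eq_one_iff_eq hw₂.ne'] at hmean
  rw [hmean.1] at hΩ₁
  rw [hmean.2] at hΩ₂
  have hcorr := powerCorrelation_of_hasLaw_normalizedLaw hlaw hp0 hp1
  rw [powerCorrelation_div_const P R₁ R₂ hs₁ hs₂, ← hρ] at hcorr
  -- The scales and the dependence parameter of the density are now identified with `Ω₁`, `Ω₂` and
  -- `ρ`.
  subst hΩ₁ hΩ₂ hcorr
  have hq : 0 < 1 - ρ := by linarith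
  have ha0 : 0 < a := ha ▸ Real.sqrt_pos.2 (by positivity)
  have ha2 : a ^ 2 = 2 * ((M + 1 : ℕ) : ℝ) / (1 - ρ) := by
    rw [ha, Real.sq_sqrt (by positivity)]
  refine ⟨fun r₁ r₂ hr₁ hr₂ => ?_, fun r₁ r₂ => ?_⟩
  · rw [jointCDF_of_hasLaw_normalizedLaw hlaw hp0 hp1 ha0 ha2 hb hr₁ hr₂, Nat.add_sub_cancel,
      marcumTail, ← sub_add, Finset.mul_sum]
    have hT : ((M + 1 : ℕ) : ℝ) * r₁ ^ 2 / ρ ≠ 0 := by positivity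
    -- With these `q` and `T`, the quantity `q ^ 2 * z / T` is `m * r₂ ^ 2`, so the collapsed sum is
    -- the second sum of `marcumTail` without its exponential factor.
    have hsum := sum_coeffA (M + 1) (q := (1 - ρ) / ρ) hT ((r₁ * r₂ * a * b) ^ 2 / 4)
      fun n => marcumQ n (r₂ * b) (r₁ * a)
    have hz : ((1 - ρ) / ρ) ^ 2 * ((r₁ * r₂ * a * b) ^ 2 / 4) / (((M + 1 : ℕ) : ℝ) * r₁ ^ 2 / ρ) =
        ((M + 1 : ℕ) : ℝ) * r₂ ^ 2 := by
      have : (r₁ * r₂ * a * b) ^ 2 = (r₁ * r₂) ^ 2 * (a ^ 2) ^ 2 * ρ := by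
        rw [hb, ← Real.sq_sqrt hp0.le, Real.sqrt_sq (Real.sqrt_nonneg _)]
        ring
      rw [this, ha2]
      field_simp
      ring
    rw [hz] at hsum
    simp only [div_pow, div_div, mul_comm (ρ ^ _)] at hsum ⊢
    rw [hsum, Finset.mul_sum]
    simp only [mul_assoc]
  · have e : {s | R₁ s ≤ r₁ ∧ R₂ s ≤ r₂} =
        {s | R₁ s / √Ω₁ ≤ r₁ / √Ω₁ ∧ R₂ s / √Ω₂ ≤ r₂ / √Ω₂} := by
      ext s
      simp only [Set.mem_ofPred_eq, div_le_div_iff_of_pos_right hs₁,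
        div_le_div_iff_of_pos_right hs₂]
    rw [jointCDF, jointCDF, e]
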